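/- Let $\mathcal U,\mathcal V,\mathcal X,\mathcal Y,\mathcal S,\mathcal Z$ be finite sets and let $R>0$. All logarithms are to base 2. **Source and channel.** A finite-state source with initial state $s_1\in\mathcal S$ emits $(\boldsymbol u,\boldsymbol v)\in\mathcal U^n\times\mathcal V^n$ with probability $P(\boldsymbol u,\boldsymbol v)=\prod_{t=1}^nP(u_t,v_t|s_t)$, $s_t=g(s_{t-1},u_{t-1},v_{t-1})$. A finite-state channel with initial state $z_1\in\mathcal Z$ has transition law $W(\boldsymbol y|\boldsymbol x)=\prod_{t=1}^nW(y_t|x_t,z_t)$, $z_t=h(z_{t-1},x_{t-1},y_{t-1})$. Assume that the side information never resolves the source: there is an $L$ such that for all $n\ge L$ and all $(\boldsymbol u,\boldsymbol v)$ of length $n$ with $P(\boldsymbol u,\boldsymbol v)>0$ there is $\boldsymbol u'\ne\boldsymbol u$ with $u'_t=u_t$ for all $t\le n-L$ and $P(\boldsymbol u',\boldsymbol v)>0$ (for instance, $|\mathcal U|\ge2$ and all $P(u,v|s)>0$). **Coding.** For each $n$, every $\boldsymbol u\in\mathcal U^n$ is assigned independently and uniformly at random to one of $M=\lceil2^{nR}\rceil$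 bins, $f(\boldsymbol u)\in\{1,\dots,M\}$, and codewords $\boldsymbol x(1),\dots,\boldsymbol x(M)\in\mathcal X^n$ are drawn independently from a probability distribution $Q=Q_n$ on $\mathcal X^n$, all independently of the source. Write $\boldsymbol x[\boldsymbol u]=\boldsymbol x(f(\boldsymbol u))$. When the source emits $(\boldsymbol u,\boldsymbol v)$, $\boldsymbol x[\boldsymbol u]$ is sent over the channel; the decoder knows $f$, the codebook, $\boldsymbol v$ and the channel output $\boldsymbol y$. Assume that either every $Q_n$ is exchangeable (invariant under permutations of the coordinates), or, more generally, the channel state has a component $\sigma_t$ that evolves as a function of $(\sigma_{t-1},x_{t-1})$ only, and every $Q_n(\boldsymbol x)$ depends only on the joint type of $(\boldsymbol x,\boldsymbol\sigma)$, where $\boldsymbol\sigma=(\sigma_1,\dots,\sigma_n)$ is the sequence induced by $\boldsymbol x$. **Decoders.** For sequences $\boldsymbol a,\boldsymbol b$ of length $n$, parse $((a_1,b_1),\dots,(a_n,b_n))$ incrementally (Lempel–Ziv 1978) into phrases, let $b(1),\dots,b(c)$ be the distinct $b$-phrases that occur, let $c_\ell(\boldsymbol a|\boldsymbol b)$ be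 the number of distinct $a$-phrases that appear jointly with $b(\ell)$, and let $\hat H_{LZ}(\boldsymbol a|\boldsymbol b)=\frac1n\sum_{\ell=1}^{c}c_\ell(\boldsymbol a|\boldsymbol b)\log c_\ell(\boldsymbol a|\boldsymbol b)$, where a last phrase left incomplete by the parsing, which repeats an earlier phrase, is not counted. Put $\hat I_{LZ}(\boldsymbol x;\boldsymbol y)=-\frac1n\log Q(\boldsymbol x)-\hat H_{LZ}(\boldsymbol x|\boldsymbol y)$. The MAP decoder outputs a maximizer over $\boldsymbol u\in\mathcal U^n$ of $P(\boldsymbol u,\boldsymbol v)W(\boldsymbol y|\boldsymbol x[\boldsymbol u])$; the universal decoder outputs a maximizer over $\boldsymbol u\in\mathcal U^n$ of $\hat I_{LZ}(\boldsymbol x[\boldsymbol u];\boldsymbol y)-\hat H_{LZ}(\boldsymbol u|\boldsymbol v)$; ties are broken in any way. Let $P_e^{MAP}(n)$ and $P_e^{u}(n)$ be their probabilities of not reproducing the source vector, averaged over source, channel, binning and codebook. **Claim.** For all sufficiently large $n$ both error probabilities are positive, and $$\lim_{n\to\infty}\frac1n\log\frac{P_e^{u}(n)}{P_e^{MAP}(n)}=0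 .$$ -/

import Mathlib

open Filter Topology

/-! ### Finite-state sources and channels

Sequences of length `n` are functions on `Fin n`; time runs through `0, …, n - 1`. -/

/-- A nonnegative function on a finite set with total mass one. -/
def IsDistribution {A : Type*} [Fintype A] (q : A → ℝ) : Prop :=
  (∀ a, 0 ≤ q a) ∧ ∑ a, q a = 1

/-- A finite-state source of pairs: in state `s` the pair `(u, v)` is emitted with probability
`prob s (u, v)`, after which the state becomes `next s u v`. -/
structure FiniteStateSource (U V S : Type*) [Fintype U] [Fintype V] where
  next : S → U → V → S
  prob : S → U × V → ℝ
  isDistribution : ∀ s, IsDistribution (prob s)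

/-- A finite-state channel: in state `z`, input `x` produces output `y` with probability
`prob z x y`, after which the state becomes `next z x y`. -/
structure FiniteStateChannel (X Y Z : Type*) [Fintype Y] where
  next : Z → X → Y → Z
  prob : Z → X → Y → ℝ
  isDistribution : ∀ z x, IsDistribution (prob z x)

/-- The state before time `t` of an automaton that starts in `s` and is driven by the letters
`a 0, a 1, …`. -/
def driveState {A S : Type*} {n : ℕ} (step : S → A → S) (s : S) (a : Fin n → A) : ℕ → S
  | 0 => s
  | t + 1 =>
    if h : t < n then step (driveState step s a t) (a ⟨t, h⟩) else driveState step s a t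

section SourceAndChannel

variable {U V S X Y Z : Type*} [Fintype U] [Fintype V] [Fintype Y] {n : ℕ}

/-- `P(u, v) = ∏ₜ P(uₜ, vₜ | sₜ)`, with initial state `s`. -/
def FiniteStateSource.seqProb (src : FiniteStateSource U V S) (s : S)
    (u : Fin n → U) (v : Fin n → V) : ℝ :=
  ∏ t : Fin n,
    src.prob (driveState (fun s (a : U × V) => src.next s a.1 a.2) s (fun i => (u i, v i)) t)
      (u t, v t)

/-- `W(y | x) = ∏ₜ W(yₜ | xₜ, zₜ)`, with initial state `z`. -/
def FiniteStateChannel.seqProb (W : FiniteStateChannel X Y Z) (z : Z)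
    (x : Fin n → X) (y : Fin n → Y) : ℝ :=
  ∏ t : Fin n,
    W.prob (driveState (fun z (a : X × Y) => W.next z a.1 a.2) z (fun i => (x i, y i)) t)
      (x t) (y t)

/-- The side information never resolves the source: for some `L`, the last `L` source letters
are never determined with certainty by the earlier source letters and the whole side-information
sequence. A source all of whose letter probabilities `P(u, v | s)` are positive, over an alphabet
`U` with at least two letters, has this property with `L = 1`. -/
def FiniteStateSource.Ambiguous (src : FiniteStateSource U V S) (s : S) : Prop :=
  ∃ L : ℕ, ∀ n : ℕ, L ≤ n → ∀ (u : Fin n → U) (v : Fin n → V), 0 < src.seqProb s u v →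
    ∃ u' : Fin n → U, u' ≠ u ∧ (∀ t : Fin n, (t : ℕ) + L < n → u' t = u t) ∧
      0 < src.seqProb s u' v

/-- A component `σ = proj z` of the channel state, with values in `T`, that is driven by the
channel input alone. -/
structure InputDrivenComponent (W : FiniteStateChannel X Y Z) (T : Type*) where
  proj : Z → T
  next : T → X → T
  compat : ∀ z x y, proj (W.next z x y) = next (proj z) x

/-- The sequence `σ` induced by the input `x` when the channel starts in state `z`. -/
def InputDrivenComponent.seq {T : Type*} {W : FiniteStateChannel X Y Z}
    (c : InputDrivenComponent W T) (z : Z) (x : Fin n → X) (t : Fin n) : T :=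
  driveState c.next (c.proj z) x t

/-- Equal joint empirical distributions: `a'` is a rearrangement of `a`. -/
def SameType {A : Type*} (a a' : Fin n → A) : Prop :=
  ∃ π : Equiv.Perm (Fin n), a' = a ∘ π

/-- An exchangeable function on sequences. -/
def Exchangeable (q : (Fin n → X) → ℝ) : Prop :=
  ∀ x x' : Fin n → X, SameType x x' → q x' = q x

/-- Invariance within conditional types given `σ`: `q x` depends only on the joint type of
`(x, σ)`, where `σ` is the component sequence induced by `x`. -/
def InputDrivenComponent.Invariant {T : Type*} {W : FiniteStateChannel X Y Z}
    (c : InputDrivenComponent W T) (z : Z) (q : (Fin n → X) → ℝ) : Prop :=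
  ∀ x x' : Fin n → X,
    SameType (fun t => (x t, c.seq z x t)) (fun t => (x' t, c.seq z x' t)) → q x' = q x

end SourceAndChannel

/-! ### Conditional Lempel-Ziv compressibility -/

section LempelZiv

/-- Incremental parsing: `dict` holds the completed phrases, `cur` the phrase under construction.
A phrase is completed as soon as it differs from all completed phrases. A last phrase left
incomplete repeats an earlier phrase, so the result lists the distinct phrases, each once. -/
def lzParse {A : Type*} [DecidableEq A] (dict : List (List A)) (cur : List A) :
    List A → List (List A)
  | [] => dict
  | a :: l =>
    if cur ++ [a] ∈ dict then lzParse dict (cur ++ [a]) l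
    else lzParse (dict ++ [cur ++ [a]]) [] l

variable {X Y : Type*} [DecidableEq X] [DecidableEq Y] {n : ℕ}

/-- The distinct phrases in the joint incremental parsing of `((x₁, y₁), …, (xₙ, yₙ))`. -/
def jointPhrases (x : Fin n → X) (y : Fin n → Y) : List (List (X × Y)) :=
  lzParse [] [] (List.ofFn fun t => (x t, y t))

/-- The distinct `y`-phrases in the joint parsing. -/
def sidePhrases (x : Fin n → X) (y : Fin n → Y) : Finset (List Y) :=
  ((jointPhrases x y).map (List.map Prod.snd)).toFinset

/-- The number of distinct `x`-phrases that appear jointly with the `y`-phrase `w`. -/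
def phraseCount (x : Fin n → X) (y : Fin n → Y) (w : List Y) : ℕ :=
  ((jointPhrases x y).toFinset.filter (fun p => p.map Prod.snd = w)).card

/-- `Ĥ_LZ(x | y) = (1/n) ∑_ℓ c_ℓ(x|y) log₂ c_ℓ(x|y)`, the sum being over the distinct
`y`-phrases. -/
noncomputable def condLZ (x : Fin n → X) (y : Fin n → Y) : ℝ :=
  (∑ w ∈ sidePhrases x y, (phraseCount x y w : ℝ) * Real.logb 2 (phraseCount x y w)) / n

/-- `Î_LZ(x; y) = -(1/n) log₂ Q(x) - Ĥ_LZ(x | y)`. -/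
noncomputable def infoLZ (q : (Fin n → X) → ℝ) (x : Fin n → X) (y : Fin n → Y) : ℝ :=
  -(Real.logb 2 (q x)) / n - condLZ x y

end LempelZiv

/-! ### Random binning, random coding and decoding -/

section System

/-- The number of bins `2^{nR}`, rounded up to an integer. -/
noncomputable def numBins (R : ℝ) (n : ℕ) : ℕ := ⌈(2 : ℝ) ^ ((n : ℝ) * R)⌉₊

/-- A decoder sees the binning function `f`, the codebook `C`, the side information and the
channel output. -/
abbrev Decoder (U V X Y : Type*) (n M : ℕ) : Type _ :=
  ((Fin n → U) → Fin M) → (Fin M → Fin n → X) → (Fin n → V) → (Fin n → Y) → (Fin n → U)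

variable {U V S X Y Z : Type*} [Fintype U] [Fintype V] [Fintype X] [Fintype Y] {n M : ℕ}

/-- `d` outputs a maximizer of `P(u, v) W(y | x[u])`; ties are broken arbitrarily. -/
def IsMAPDecoder (src : FiniteStateSource U V S) (s : S) (W : FiniteStateChannel X Y Z) (z : Z)
    (d : Decoder U V X Y n M) : Prop :=
  ∀ f C v y u, src.seqProb s u v * W.seqProb z (C (f u)) y ≤
    src.seqProb s (d f C v y) v * W.seqProb z (C (f (d f C v y))) y

/-- `d` outputs a maximizer of `Î_LZ(x[u]; y) - Ĥ_LZ(u | v)`; ties are broken arbitrarily. -/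
def IsLZDecoder [DecidableEq U] [DecidableEq V] [DecidableEq X] [DecidableEq Y]
    (q : (Fin n → X) → ℝ) (d : Decoder U V X Y n M) : Prop :=
  ∀ f C v y u, infoLZ q (C (f u)) y - condLZ u v ≤
    infoLZ q (C (f (d f C v y))) y - condLZ (d f C v y) v

/-- The average error probability `Pr{d ≠ U}`: every source vector is assigned to one of the `M`
bins uniformly, the `M` codewords are drawn from `q`, all independently of each other and of the
source, and the codeword of the bin of the source vector is sent over the channel. -/
noncomputable def errorProb [DecidableEq U]
    (src : FiniteStateSource U V S) (s : S) (W : FiniteStateChannel X Y Z) (z : Z)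
    (q : (Fin n → X) → ℝ) (d : Decoder U V X Y n M) : ℝ :=
  ∑ f : (Fin n → U) → Fin M, ∑ C : Fin M → Fin n → X,
    ∑ u : Fin n → U, ∑ v : Fin n → V, ∑ y : Fin n → Y,
      (∏ _u : Fin n → U, (1 / (M : ℝ))) * (∏ j, q (C j)) *
        (src.seqProb s u v * W.seqProb z (C (f u)) y) * (if d f C v y ≠ u then 1 else 0)

end System

/-! The MAP decoder is optimal, so the ratio is at least 1; the work is to bound it above by a
subexponential factor. Write `α(u) = 2^(n Ĥ_LZ(u|v))` and `β(x) = 2^(n Ĥ_LZ(x|y))` (both are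
`lzWeight`). The universal decoder minimizes `Q(x[u]) β(x[u]) α(u)`. Fix the true `u`, `v`, the sent
codeword `x` and the output `y`.

Upper bound. If the universal decoder errs, some `u' ≠ u` has a product no larger than that of `u`.
By the union bound this has probability at most `K² α(u) (1/M + Q(x) β(x))`, where the term `1/M`
comes from vectors sharing the bin of `u`. This needs only `∑ 1/α ≤ K` and `∑ 1/β ≤ K`, a Kraft
inequality with subexponential `K` (`eventually_sum_inv_lzWeight_le`).

Lower bound. Any decoder errs, up to a constant, as often as the true vector has a competitor of
comparable weight `P W` (`sum_competitor_le`). Permuting phrases that agree in side phrase and in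
initial and final state rearranges the steps of the finite-state path. This changes neither `P`, `W`
nor `Q`, and produces at least `α(u)/K` vectors like `u` and `β(x)/K` codewords like `x`
(`eventually_lzWeight_le_card_pathClass`). The second-moment method shows that such a competitor is
present with probability of order `min(1, α(u) (1/M + Q(x) β(x)))`, up to powers of `K`
(`le_codeMean_sent_exists`).

The two bounds match for each `(u, v, x, y)` (`codeMean_sent_compare`), and averaging gives
`errorProb_lz_le`. Ambiguity of the source is needed when the class of `u` is just `{u}`: it
supplies one competitor whose probability is smaller by at most a constant factor. It also makes the
error probabilities positive. -/

/-! ### Incremental parsings -/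

section Parsing

/-- The lists of phrases that incremental parsing can produce: every phrase is new and extends
the empty word or an earlier phrase by one letter. -/
inductive Incremental {A : Type*} : List (List A) → Prop
  | nil : Incremental []
  | snoc {D : List (List A)} {p : List A} {a : A} : Incremental D → p ∈ [] :: D →
      p ++ [a] ∉ D → Incremental (D ++ [p ++ [a]])

theorem Incremental.ne_nil {A : Type*} {D : List (List A)} (h : Incremental D) :
    ∀ p ∈ D, p ≠ [] := by
  induction h with
  | nil => simp
  | snoc _ _ _ ih =>
    intro q hq
    rcases List.mem_append.1 hq with hq | hq
    · exact ih q hq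
    · simp_all

theorem Incremental.nodup {A : Type*} {D : List (List A)} (h : Incremental D) : D.Nodup := by
  induction h with
  | nil => simp
  | snoc _ _ hn ih =>
    rw [List.nodup_append]
    refine ⟨ih, by simp, ?_⟩
    rintro a ha b hb rfl
    simp_all

/-- The invariant is that the phrase under construction is empty or a completed phrase, since it is
extended only while it remains in the dictionary. At the end it is the unfinished tail `r`, which
therefore has few possible values. -/
theorem lzParse_spec {A : Type*} [DecidableEq A] (l : List A) :
    ∀ (dict : List (List A)) (cur : List A), Incremental dict → cur ∈ [] :: dict →
      Incremental (lzParse dict cur l) ∧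
      ∃ r ∈ [] :: lzParse dict cur l,
        (lzParse dict cur l).flatten ++ r = dict.flatten ++ cur ++ l := by
  induction l with
  | nil =>
    intro dict cur hd hc
    exact ⟨hd, cur, hc, by simp [lzParse]⟩
  | cons a l ih =>
    intro dict cur hd hc
    by_cases h : cur ++ [a] ∈ dict
    · have := ih dict (cur ++ [a]) hd (List.mem_cons_of_mem _ h)
      simp only [lzParse, h, if_true]
      simpa using this
    · have := ih (dict ++ [cur ++ [a]]) [] (hd.snoc hc h) (by simp)
      simp only [lzParse, h, if_false]
      simpa using this

/-- `∏ c(w) ^ c(w)` over the distinct entries `w` of a list, where `c(w)` is the multiplicity. -/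
def selfCount {B : Type*} [DecidableEq B] (ws : List B) : ℕ :=
  (ws.map fun w => ws.count w).prod

theorem selfCount_pos {B : Type*} [DecidableEq B] (ws : List B) : 0 < selfCount ws := by
  unfold selfCount
  apply List.prod_pos
  intro a ha
  obtain ⟨w, hw, rfl⟩ := List.mem_map.1 ha
  exact List.count_pos_iff.2 hw

variable {X Y : Type*} [DecidableEq X] [DecidableEq Y] {n : ℕ}

theorem incremental_jointPhrases (x : Fin n → X) (y : Fin n → Y) :
    Incremental (jointPhrases x y) :=
  (lzParse_spec _ [] [] .nil (by simp)).1

theorem exists_flatten_jointPhrases (x : Fin n → X) (y : Fin n → Y) :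
    ∃ r ∈ [] :: jointPhrases x y,
      (jointPhrases x y).flatten ++ r = List.ofFn fun t => (x t, y t) := by
  simpa [jointPhrases] using (lzParse_spec (List.ofFn fun t => (x t, y t)) [] [] .nil (by simp)).2

/-- The side-information phrases in the order in which they occur. -/
def sideList (x : Fin n → X) (y : Fin n → Y) : List (List Y) :=
  (jointPhrases x y).map (List.map Prod.snd)

/-- The joint phrases are distinct, so counting distinct phrases over `w` is counting occurrences of
`w`. -/
theorem phraseCount_eq_count (x : Fin n → X) (y : Fin n → Y) (w : List Y) :
    phraseCount x y w = (sideList x y).count w := by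
  have h : (jointPhrases x y).toFinset.filter (fun p => p.map Prod.snd = w) =
      ((jointPhrases x y).filter fun p => p.map Prod.snd = w).toFinset := by
    ext p
    simp
  unfold phraseCount sideList
  rw [h, List.toFinset_card_of_nodup ((incremental_jointPhrases x y).nodup.filter _), List.count,
    List.countP_map, List.countP_eq_length_filter]
  congr 2
  ext p
  rw [Function.comp_apply, Bool.eq_iff_iff]
  simp

theorem logb_selfCount {B : Type*} [DecidableEq B] (ws : List B) :
    Real.logb 2 (selfCount ws) = ∑ w ∈ ws.toFinset, (ws.count w : ℝ) * Real.logb 2 (ws.count w) := by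
  unfold selfCount
  rw [Finset.prod_list_map_count]
  push_cast
  rw [Real.logb_prod]
  · exact Finset.sum_congr rfl fun w _ => Real.logb_pow _ _ _
  · intro w hw
    have h := List.count_pos_iff.2 (List.mem_toFinset.1 hw)
    exact pow_ne_zero _ (Nat.cast_ne_zero.2 h.ne')

/-- `2 ^ (n Ĥ_LZ(x | y))` as a natural number. -/
def lzWeight (x : Fin n → X) (y : Fin n → Y) : ℕ := selfCount (sideList x y)

theorem lzWeight_pos (x : Fin n → X) (y : Fin n → Y) : 0 < lzWeight x y := selfCount_pos _

theorem condLZ_eq (x : Fin n → X) (y : Fin n → Y) :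
    condLZ x y = Real.logb 2 (lzWeight x y) / n := by
  unfold condLZ lzWeight
  rw [logb_selfCount]
  congr 1
  refine Finset.sum_congr rfl fun w _ => ?_
  rw [phraseCount_eq_count]
  congr!

/-- Families of distinct words of total length `n` have `o(n)` members. -/
theorem eventually_length_le (A : Type*) [Finite A] {δ : ℝ} (hδ : 0 < δ) :
    ∀ᶠ n : ℕ in atTop, ∀ D : List (List A), D.Nodup → D.flatten.length ≤ n →
      (D.length : ℝ) ≤ δ * n := by
  classical
  -- There are only finitely many words shorter than `m`, fewer than `δ n / 2` for large `n`; at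
  -- most `n / m ≤ δ n / 2` words are longer. Sublinearity is all that is needed, without the rate
  -- `n / log n`.
  obtain ⟨m, hm⟩ := exists_nat_gt (2 / δ)
  have hm0 : (0 : ℝ) < m := lt_trans (by positivity) hm
  set F := (List.finite_length_lt A m).toFinset with hF
  obtain ⟨N, hN⟩ := exists_nat_gt (2 * F.card / δ)
  filter_upwards [eventually_ge_atTop N] with n hn D hD hlen
  have hsplit : D.length = (D.filter fun p => p.length < m).length +
      (D.filter fun p => ¬ p.length < m).length := by
    rw [List.length_eq_length_filter_add (l := D) (fun p => decide (p.length < m))]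
    congr 2
    exact List.filter_congr fun p _ => by by_cases h : p.length < m <;> simp [h]
  have hshort : (D.filter fun p => p.length < m).length ≤ F.card := by
    rw [← List.toFinset_card_of_nodup (hD.filter _)]
    apply Finset.card_le_card
    intro p hp
    simp only [List.mem_toFinset, List.mem_filter, decide_eq_true_eq] at hp
    simpa [hF] using hp.2
  have hlong : m * (D.filter fun p => ¬ p.length < m).length ≤ D.flatten.length := by
    clear hsplit hD hlen hshort
    induction D with
    | nil => simp
    | cons p D ih =>
      by_cases h : p.length < m
      · simp only [List.filter_cons, h, List.flatten_cons, List.length_append]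
        simp only [not_true, decide_false]
        simpa using le_trans ih (Nat.le_add_left _ _)
      · simp only [List.filter_cons, h, List.flatten_cons, List.length_append]
        simp only [not_false_iff, decide_true, if_true, List.length_cons]
        rw [mul_add]
        have : m ≤ p.length := by omega
        omega
  have h1 : (F.card : ℝ) ≤ δ / 2 * n := by
    rw [div_lt_iff₀ hδ] at hN
    have : (N : ℝ) ≤ n := by exact_mod_cast hn
    nlinarith
  have h2 : ((D.filter fun p => ¬ p.length < m).length : ℝ) ≤ δ / 2 * n := by
    rw [div_lt_iff₀ hδ] at hm
    have h3 : (m : ℝ) * ((D.filter fun p => ¬ p.length < m).length : ℝ) ≤ n := by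
      exact_mod_cast hlong.trans hlen
    have h4 : (0 : ℝ) ≤ ((D.filter fun p => ¬ p.length < m).length : ℝ) := by positivity
    nlinarith
  have h5 : ((D.filter fun p => p.length < m).length : ℝ) ≤ F.card := by exact_mod_cast hshort
  rw [hsplit]
  push_cast
  linarith

theorem eventually_length_jointPhrases_le (X Y : Type*) [Finite X] [Finite Y] [DecidableEq X]
    [DecidableEq Y] {δ : ℝ} (hδ : 0 < δ) :
    ∀ᶠ n : ℕ in atTop, ∀ (x : Fin n → X) (y : Fin n → Y),
      ((jointPhrases x y).length : ℝ) ≤ δ * n := by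
  filter_upwards [eventually_length_le (X × Y) hδ] with n hn x y
  refine hn _ (incremental_jointPhrases x y).nodup ?_
  obtain ⟨r, -, hr⟩ := exists_flatten_jointPhrases x y
  have := congrArg List.length hr
  rw [List.length_append, List.length_ofFn] at this
  omega

end Parsing

/-! ### A Kraft inequality for conditional Lempel-Ziv compressibility -/

section Kraft

/-- Prepend a letter to the first word of a list of words. -/
def consHead {B : Type*} (b : B) : List (List B) → List (List B)
  | [] => []
  | w :: ws => (b :: w) :: ws

/-- All ways to cut a prefix of a word into nonempty words. -/
def splittings {B : Type*} : List B → List (List (List B))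
  | [] => [[]]
  | b :: l => (splittings l).map (fun ws => [b] :: ws) ++ (splittings l).map (consHead b)

theorem mem_splittings {B : Type*} (l : List B) :
    ∀ ws : List (List B), (∀ w ∈ ws, w ≠ []) → ws.flatten <+: l → ws ∈ splittings l := by
  induction l with
  | nil =>
    intro ws h0 hp
    cases ws with
    | nil => simp [splittings]
    | cons w ws =>
      have : w = [] := (by simpa using List.prefix_nil.1 hp : w = [] ∧ _).1
      exact absurd this (h0 w (by simp))
  | cons b l ih =>
    intro ws h0 hp
    rw [splittings, List.mem_append, List.mem_map, List.mem_map]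
    match ws with
    -- `consHead b [] = []` is what drops the letters after the cut prefix.
    | [] => exact Or.inr ⟨[], ih [] (by simp) (by simp), rfl⟩
    | [] :: ws => exact absurd rfl (h0 [] (by simp))
    | [b'] :: ws =>
      simp only [List.flatten_cons, List.cons_append, List.nil_append, List.cons_prefix_cons] at hp
      exact Or.inl ⟨ws, ih ws (fun w hw => h0 w (by simp [hw])) hp.2, by rw [hp.1]⟩
    | (b' :: b'' :: w) :: ws =>
      simp only [List.flatten_cons, List.cons_append, List.cons_prefix_cons] at hp
      refine Or.inr ⟨(b'' :: w) :: ws, ih _ ?_ ?_, by rw [consHead, hp.1]⟩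
      · intro v hv
        rcases List.mem_cons.1 hv with rfl | hv
        · simp
        · exact h0 v (by simp [hv])
      · simpa using hp.2

/-- Each letter either forms a new one-letter word, a factor `r`, or leaves the number of words
unchanged, a factor `1`. -/
theorem sum_splittings {B : Type*} (r : ℝ) (l : List B) :
    ((splittings l).map fun ws => r ^ ws.length).sum = (1 + r) ^ l.length := by
  induction l with
  | nil => simp [splittings]
  | cons b l ih =>
    have h1 : (fun ws : List (List B) => r ^ ws.length) ∘ (fun ws => [b] :: ws) =
        fun ws => r * r ^ ws.length := by
      ext ws
      simp [pow_succ']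
    have h2 : (fun ws : List (List B) => r ^ ws.length) ∘ consHead b =
        fun ws => r ^ ws.length := by
      ext ws
      cases ws <;> simp [consHead]
    rw [splittings, List.map_append, List.sum_append, List.map_map, List.map_map, h1, h2,
      List.sum_map_mul_left, ih, List.length_cons]
    ring

theorem sum_toFinset_le_sum_map {T : Type*} [DecidableEq T] (l : List T) {f : T → ℝ}
    (hf : ∀ a, 0 ≤ f a) : ∑ a ∈ l.toFinset, f a ≤ (l.map f).sum := by
  rw [Finset.sum_list_map_count]
  refine Finset.sum_le_sum fun a ha => ?_
  have h : (1 : ℝ) ≤ l.count a := by exact_mod_cast List.count_pos_iff.2 (List.mem_toFinset.1 ha)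
  rw [nsmul_eq_mul]
  nlinarith [hf a]

theorem card_splittings_le {B : Type*} [DecidableEq B] {r : ℝ} (h0 : 0 < r) (h1 : r ≤ 1)
    (l : List B) (c : ℕ) :
    (((splittings l).toFinset.filter fun ws => ws.length ≤ c).card : ℝ) * r ^ c ≤
      (1 + r) ^ l.length := by
  rw [← sum_splittings r l]
  calc _ = ∑ ws ∈ (splittings l).toFinset.filter fun ws => ws.length ≤ c, r ^ c := by simp
    _ ≤ ∑ ws ∈ (splittings l).toFinset.filter fun ws => ws.length ≤ c, r ^ ws.length :=
      Finset.sum_le_sum fun ws hws =>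
        pow_le_pow_of_le_one h0.le h1 (Finset.mem_filter.1 hws).2
    _ ≤ ∑ ws ∈ (splittings l).toFinset, r ^ ws.length :=
      Finset.sum_le_sum_of_subset_of_nonneg (Finset.filter_subset _ _) fun _ _ _ => by positivity
    _ ≤ _ := sum_toFinset_le_sum_map _ fun _ => by positivity

/-- With given second components, every phrase is determined by an earlier phrase with a
prescribed second component and by one letter. -/
theorem exists_finset_incremental {A B : Type*} [Fintype A] [DecidableEq A] [DecidableEq B]
    (ws : List (List B)) :
    ∃ F : Finset (List (List (A × B))),
      (∀ D, Incremental D → D.map (List.map Prod.snd) = ws → D ∈ F) ∧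
      (∀ D ∈ F, D.map (List.map Prod.snd) = ws) ∧
      ∀ g : List B → ℕ, (∀ w, ([] :: ws).count w ≤ g w) →
        F.card ≤ (ws.map fun w => Fintype.card A * g w.dropLast).prod := by
  induction ws using List.reverseRecOn with
  | nil => exact ⟨{[]}, by simp, by simp, by simp⟩
  | append_singleton ws w ih =>
    obtain ⟨F, hF, hF', hcard⟩ := ih
    rcases List.eq_nil_or_concat w with rfl | ⟨w, b, rfl⟩
    · refine ⟨∅, ?_, by simp, by simp⟩
      intro D hD h
      have : ([] : List B) ∈ D.map (List.map Prod.snd) := by simp [h]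
      obtain ⟨p, hp, hp'⟩ := List.mem_map.1 this
      exact absurd (List.map_eq_nil_iff.1 hp') (hD.ne_nil p hp)
    -- Possible parents of the new phrase: the empty root and the earlier phrases with side
    -- component `w`.
    let par (D : List (List (A × B))) : Finset (List (A × B)) :=
      (([] :: D).filter fun p => p.map Prod.snd = w).toFinset
    have hpar : ∀ D ∈ F, (par D).card ≤ ([] :: ws).count w := by
      intro D hD
      have : [] :: ws = ([] :: D).map (List.map Prod.snd) := by simp [hF' D hD]
      rw [this, List.count, List.countP_map, List.countP_eq_length_filter]
      refine (List.toFinset_card_le _).trans (le_of_eq ?_)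
      congr 2
      ext p
      rw [Function.comp_apply, Bool.eq_iff_iff]
      simp
    refine ⟨F.biUnion fun D => (par D ×ˢ Finset.univ).image
      fun pa => D ++ [pa.1 ++ [(pa.2, b)]], ?_, ?_, ?_⟩
    · intro D hD h
      cases hD with
      | nil => simp at h
      | @snoc D p a hD hp hn =>
        rw [List.map_append, List.map_singleton, List.map_append, List.map_singleton,
          List.concat_eq_append] at h
        obtain ⟨h1, h2⟩ := List.append_inj' h (by simp)
        obtain ⟨h3, h4⟩ := List.append_inj' (List.singleton_inj.1 h2) (by simp)
        refine Finset.mem_biUnion.2 ⟨D, hF D hD h1, Finset.mem_image.2 ⟨(p, a.1), ?_, ?_⟩⟩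
        · refine Finset.mem_product.2 ⟨List.mem_toFinset.2 (List.mem_filter.2 ⟨hp, ?_⟩),
            Finset.mem_univ _⟩
          simpa using h3
        · rw [← List.singleton_inj.1 h4]
    · intro D hD
      obtain ⟨D, hDF, hD⟩ := Finset.mem_biUnion.1 hD
      obtain ⟨⟨p, a⟩, hp, rfl⟩ := Finset.mem_image.1 hD
      have := (List.mem_filter.1 (List.mem_toFinset.1 (Finset.mem_product.1 hp).1)).2
      simp only [decide_eq_true_eq] at this
      simp [hF' D hDF, this]
    · intro g hg
      -- Counts only grow along the list, so a majorant `g` of the final counts serves at every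
      -- stage of the induction.
      have hg' : ∀ v, ([] :: ws).count v ≤ g v := fun v =>
        le_trans (by rw [← List.cons_append, List.count_append]; omega) (hg v)
      rw [List.map_append, List.prod_append, List.map_singleton, List.prod_singleton,
        List.concat_eq_append, List.dropLast_concat]
      refine le_trans (Finset.card_biUnion_le_card_mul F _ (Fintype.card A * g w) ?_)
        (Nat.mul_le_mul_right _ (hcard g hg'))
      intro D hD
      refine Finset.card_image_le.trans ?_
      rw [Finset.card_product, mul_comm, Finset.card_univ]
      exact Nat.mul_le_mul_left _ ((hpar D hD).trans (hg' w))

/-- A word is the parent of at most `|B|` distinct words, so every entry of `[] :: ws` is counted at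
most `|B|` times. -/
theorem sum_count_dropLast_le {B : Type*} [Fintype B] [DecidableEq B] (ws : List (List B))
    (h0 : ∀ w ∈ ws, w ≠ []) :
    ∑ w ∈ ws.toFinset, ([] :: ws).count w.dropLast ≤ Fintype.card B * (ws.length + 1) := by
  set vs : List (List B) := [] :: ws with hvs
  calc ∑ w ∈ ws.toFinset, vs.count w.dropLast
      ≤ ∑ w ∈ (vs.toFinset ×ˢ (Finset.univ : Finset B)).image (fun pb => pb.1 ++ [pb.2]),
          vs.count w.dropLast := by
        rw [← Finset.sum_filter_add_sum_filter_not ws.toFinset (fun w => w.dropLast ∈ vs)]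
        rw [Finset.sum_eq_zero (s := ws.toFinset.filter fun w => ¬ w.dropLast ∈ vs)
          (fun w hw => List.count_eq_zero.2 (Finset.mem_filter.1 hw).2), add_zero]
        refine Finset.sum_le_sum_of_subset fun w hw => ?_
        obtain ⟨h1, h2⟩ := Finset.mem_filter.1 hw
        have h3 := h0 w (List.mem_toFinset.1 h1)
        exact Finset.mem_image.2 ⟨(w.dropLast, w.getLast h3),
          Finset.mem_product.2 ⟨List.mem_toFinset.2 h2, Finset.mem_univ _⟩,
          List.dropLast_append_getLast h3⟩
    _ ≤ ∑ pb ∈ vs.toFinset ×ˢ (Finset.univ : Finset B), vs.count (pb.1 ++ [pb.2]).dropLast := by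
        apply le_of_eq
        apply Finset.sum_image
        rintro ⟨p, b⟩ - ⟨p', b'⟩ - h
        simpa using h
    _ = Fintype.card B * (ws.length + 1) := by
        rw [Finset.sum_product_right]
        simp only [List.dropLast_concat]
        rw [Finset.sum_const, smul_eq_mul, Finset.card_univ, ← List.length_cons (a := []), ← hvs,
          ← List.sum_toFinset_count_eq_length vs]
        congr!

/-- From `g ≤ c · exp (g / c)` follows `g ^ c ≤ exp g · c ^ c`. This exchanges parent counts for the
counts of the words themselves, at a cost exponential only in the number of phrases. -/
theorem prod_map_le_exp_mul_selfCount {T : Type*} [DecidableEq T] (l : List T) (g : T → ℕ) :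
    (((l.map g).prod : ℕ) : ℝ) ≤ Real.exp (∑ a ∈ l.toFinset, (g a : ℝ)) * selfCount l := by
  have hpos : ∀ a ∈ l.toFinset, (0 : ℝ) < l.count a := fun a ha => by
    exact_mod_cast List.count_pos_iff.2 (List.mem_toFinset.1 ha)
  unfold selfCount
  rw [Finset.prod_list_map_count, Finset.prod_list_map_count]
  push_cast
  calc ∏ a ∈ l.toFinset, (g a : ℝ) ^ l.count a
      ≤ ∏ a ∈ l.toFinset, (Real.exp (g a) * (l.count a : ℝ) ^ l.count a) := by
        refine Finset.prod_le_prod (fun a _ => by positivity) fun a ha => ?_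
        have hc := hpos a ha
        have h1 : (g a : ℝ) ≤ Real.exp (g a / l.count a) * l.count a := by
          rw [← div_le_iff₀ hc]
          linarith [Real.add_one_le_exp ((g a : ℝ) / l.count a)]
        calc (g a : ℝ) ^ l.count a
            ≤ (Real.exp (g a / l.count a) * l.count a) ^ l.count a :=
              pow_le_pow_left₀ (by positivity) h1 _
          _ = _ := by
              rw [mul_pow, ← Real.exp_nat_mul, mul_div_cancel₀ _ hc.ne']
    _ = _ := by
        rw [Finset.prod_mul_distrib, Real.exp_sum]

theorem prod_parent_count_le {B : Type*} [Fintype B] [DecidableEq B] (ws : List (List B))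
    (h0 : ∀ w ∈ ws, w ≠ []) :
    (((ws.map fun w => ([] :: ws).count w.dropLast).prod : ℕ) : ℝ) ≤
      Real.exp (Fintype.card B * (ws.length + 1)) * selfCount ws := by
  refine (prod_map_le_exp_mul_selfCount ws _).trans
    (mul_le_mul_of_nonneg_right (Real.exp_le_exp.2 ?_) (Nat.cast_nonneg _))
  exact_mod_cast sum_count_dropLast_le ws h0

theorem sideList_ne_nil {U V : Type*} [DecidableEq U] [DecidableEq V] {n : ℕ}
    (u : Fin n → U) (v : Fin n → V) : ∀ w ∈ sideList u v, w ≠ [] := by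
  intro w hw
  obtain ⟨p, hp, rfl⟩ := List.mem_map.1 hw
  simpa using (incremental_jointPhrases u v).ne_nil p hp

theorem flatten_sideList_prefix {U V : Type*} [DecidableEq U] [DecidableEq V] {n : ℕ}
    (u : Fin n → U) (v : Fin n → V) :
    (sideList u v).flatten <+: List.ofFn v := by
  obtain ⟨r, -, hr⟩ := exists_flatten_jointPhrases u v
  refine ⟨r.map Prod.snd, ?_⟩
  have := congrArg (List.map Prod.snd) hr
  rw [List.map_append, List.map_flatten, List.map_ofFn] at this
  exact this

variable {U V : Type*} [Fintype U] [Fintype V] [DecidableEq U] [DecidableEq V] {n : ℕ}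

/-- A vector is determined by its completed phrases and its unfinished tail. The tail has `ws.length
+ 1` possible values, and each completed phrase is a parent plus one letter. -/
theorem card_sideList_eq_le (v : Fin n → V) (ws : List (List V)) (h0 : ∀ w ∈ ws, w ≠ []) :
    ((Finset.univ.filter fun u : Fin n → U => sideList u v = ws).card : ℝ) ≤
      Real.exp ((Fintype.card U + 1 + Fintype.card V) * ws.length + Fintype.card V) *
        selfCount ws := by
  obtain ⟨F, hF, hF', hcard⟩ := exists_finset_incremental (A := U) ws
  have h1 : (Finset.univ.filter fun u : Fin n → U => sideList u v = ws).card ≤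
      F.card * (ws.length + 1) := by
    rw [← Finset.card_image_of_injective (Finset.univ.filter fun u : Fin n → U =>
      sideList u v = ws) (List.ofFn_injective (n := n))]
    refine (Finset.card_le_card (t := F.biUnion fun D => ([] :: D).toFinset.image
      fun r => (D.flatten ++ r).map Prod.fst) ?_).trans
      (Finset.card_biUnion_le_card_mul _ _ _ ?_)
    · intro l hl
      obtain ⟨u, hu, rfl⟩ := Finset.mem_image.1 hl
      obtain ⟨r, hr, hr'⟩ := exists_flatten_jointPhrases u v
      refine Finset.mem_biUnion.2 ⟨jointPhrases u v,
        hF _ (incremental_jointPhrases u v) (Finset.mem_filter.1 hu).2,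
        Finset.mem_image.2 ⟨r, List.mem_toFinset.2 hr, ?_⟩⟩
      rw [hr', List.map_ofFn]
      rfl
    · intro D hD
      refine Finset.card_image_le.trans ((List.toFinset_card_le _).trans (le_of_eq ?_))
      rw [List.length_cons, ← hF' D hD, List.length_map]
  have h2 : (F.card : ℝ) ≤ (Fintype.card U : ℝ) ^ ws.length *
      (Real.exp (Fintype.card V * (ws.length + 1)) * selfCount ws) := by
    refine le_trans ?_ (mul_le_mul_of_nonneg_left (prod_parent_count_le ws h0) (by positivity))
    have := hcard (fun w => ([] :: ws).count w) fun _ => le_rfl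
    rw [List.prod_map_mul, List.map_const', List.prod_replicate] at this
    exact_mod_cast this
  have h3 : (Fintype.card U : ℝ) ^ ws.length ≤ Real.exp (ws.length * Fintype.card U) := by
    rw [Real.exp_nat_mul]
    exact pow_le_pow_left₀ (by positivity)
      (by linarith [Real.add_one_le_exp (Fintype.card U : ℝ)]) _
  calc ((Finset.univ.filter fun u : Fin n → U => sideList u v = ws).card : ℝ)
      ≤ F.card * (ws.length + 1) := by exact_mod_cast h1
    _ ≤ (Real.exp (ws.length * Fintype.card U) *
          (Real.exp (Fintype.card V * (ws.length + 1)) * selfCount ws)) *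
          Real.exp ws.length := by
        refine mul_le_mul (h2.trans ?_) (Real.add_one_le_exp _) (by positivity) (by positivity)
        exact mul_le_mul_of_nonneg_right h3 (by positivity)
    _ = _ := by
        rw [show ((Fintype.card U : ℝ) + 1 + Fintype.card V) * ws.length + Fintype.card V =
          ws.length * Fintype.card U + Fintype.card V * (ws.length + 1) + ws.length by ring,
          Real.exp_add, Real.exp_add]
        ring

/-- Group the `u` by their list of side phrases. The weight is constant on a group and nearly as
large as the group, so the sum is about the number of ways to cut a prefix of `v` into at most `c`
words. -/
theorem sum_inv_lzWeight_le (v : Fin n → V) (c : ℕ)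
    (hc : ∀ u : Fin n → U, (jointPhrases u v).length ≤ c) {r : ℝ} (hr0 : 0 < r) (hr1 : r ≤ 1) :
    ∑ u : Fin n → U, (1 / (lzWeight u v : ℝ)) ≤
      (1 + r) ^ n / r ^ c *
        Real.exp ((Fintype.card U + 1 + Fintype.card V) * c + Fintype.card V) := by
  set T := (splittings (List.ofFn v)).toFinset.filter fun ws => ws.length ≤ c with hT
  have hmaps : ∀ u ∈ (Finset.univ : Finset (Fin n → U)), sideList u v ∈ T := fun u _ =>
    Finset.mem_filter.2 ⟨List.mem_toFinset.2 (mem_splittings _ _ (sideList_ne_nil u v)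
      (flatten_sideList_prefix u v)), by simpa [sideList] using hc u⟩
  rw [← Finset.sum_fiberwise_of_maps_to hmaps]
  calc _ ≤ ∑ ws ∈ T,
        Real.exp ((Fintype.card U + 1 + Fintype.card V) * c + Fintype.card V) := by
        refine Finset.sum_le_sum fun ws hws => ?_
        rw [Finset.sum_congr rfl (g := fun _ => 1 / (selfCount ws : ℝ)) fun u hu => by
          rw [lzWeight, (Finset.mem_filter.1 hu).2], Finset.sum_const, nsmul_eq_mul, mul_one_div]
        have hs : (0 : ℝ) < selfCount ws := by exact_mod_cast selfCount_pos ws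
        rcases (Finset.univ.filter fun u : Fin n → U => sideList u v = ws).eq_empty_or_nonempty
          with he | ⟨u, hu⟩
        · rw [he]
          simp only [Finset.card_empty, Nat.cast_zero, zero_div]
          positivity
        have h0 : ∀ w ∈ ws, w ≠ [] := by
          rw [← (Finset.mem_filter.1 hu).2]
          exact sideList_ne_nil u v
        rw [div_le_iff₀ hs]
        refine (card_sideList_eq_le v ws h0).trans
          (mul_le_mul_of_nonneg_right (Real.exp_le_exp.2 ?_) hs.le)
        have hlen : (ws.length : ℝ) ≤ c := by exact_mod_cast (Finset.mem_filter.1 hws).2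
        gcongr
    _ ≤ _ := by
        rw [Finset.sum_const, nsmul_eq_mul]
        refine mul_le_mul_of_nonneg_right ?_ (by positivity)
        rw [le_div_iff₀ (by positivity)]
        simpa using card_splittings_le hr0 hr1 (List.ofFn v) c

/-- Kraft's inequality up to a subexponential factor: the numbers `n Ĥ_LZ(u | v)` are
essentially the lengths of a prefix code for `u` given `v`. -/
theorem eventually_sum_inv_lzWeight_le (U V : Type*) [Fintype U] [Fintype V] [DecidableEq U]
    [DecidableEq V] {ε : ℝ} (hε : 0 < ε) :
    ∀ᶠ n : ℕ in atTop, ∀ v : Fin n → V,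
      ∑ u : Fin n → U, (1 / (lzWeight u v : ℝ)) ≤ Real.exp (ε * n) := by
  -- The exponent `ε n` is split in three: `(1 + r) ^ n ≤ exp (n r)`, all terms linear in the phrase
  -- bound `c` (total coefficient `B`), and the constant `|V|`.
  set r : ℝ := min 1 (ε / 3) with hr
  have hr0 : 0 < r := by positivity
  have hr1 : r ≤ 1 := min_le_left _ _
  have hlog : 0 ≤ -Real.log r := neg_nonneg.2 (Real.log_nonpos hr0.le hr1)
  set B : ℝ := -Real.log r + (Fintype.card U + 1 + Fintype.card V) with hB
  have hB0 : 0 < B := by positivity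
  have h1 := eventually_length_jointPhrases_le U V (δ := ε / (3 * B)) (by positivity)
  obtain ⟨N, hN⟩ := exists_nat_gt (3 * Fintype.card V / ε)
  filter_upwards [h1, eventually_ge_atTop N] with n hn hNn v
  have hc : ∀ u : Fin n → U, (jointPhrases u v).length ≤ ⌊ε / (3 * B) * n⌋₊ := fun u =>
    Nat.le_floor (hn u v)
  refine (sum_inv_lzWeight_le v _ hc hr0 hr1).trans ?_
  set c := ⌊ε / (3 * B) * n⌋₊
  have hcn : (c : ℝ) ≤ ε / (3 * B) * n := Nat.floor_le (by positivity)
  have h2 : (1 + r) ^ n ≤ Real.exp (n * r) := by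
    rw [Real.exp_nat_mul]
    exact pow_le_pow_left₀ (by positivity) (by linarith [Real.add_one_le_exp r]) _
  have h3 : r ^ c = Real.exp (c * Real.log r) := by
    rw [Real.exp_nat_mul, Real.exp_log hr0]
  rw [h3, div_eq_mul_inv, ← Real.exp_neg]
  refine (mul_le_mul_of_nonneg_right (mul_le_mul_of_nonneg_right h2 (by positivity))
    (by positivity)).trans ?_
  rw [← Real.exp_add, ← Real.exp_add]
  refine Real.exp_le_exp.2 ?_
  have h4 : (n : ℝ) * r ≤ n * (ε / 3) :=
    mul_le_mul_of_nonneg_left (min_le_right _ _) (by positivity)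
  have h5 : B * c ≤ ε / 3 * n := by
    refine (mul_le_mul_of_nonneg_left hcn hB0.le).trans (le_of_eq ?_)
    field_simp
  have h6 : (Fintype.card V : ℝ) ≤ ε / 3 * n := by
    rw [div_lt_iff₀ hε] at hN
    have : (N : ℝ) ≤ n := by exact_mod_cast hNn
    nlinarith
  rw [hB] at h5
  linarith

end Kraft

/-! ### Rearranging the phrases of a finite-state path -/

section Rearrangement

variable {S Γ : Type*}

/-- The letters of a word, each with the state in which an automaton reads it. -/
def stateTrace (step : S → Γ → S) : S → List Γ → List (S × Γ)
  | _, [] => []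
  | s, a :: l => (s, a) :: stateTrace step (step s a) l

theorem stateTrace_append (step : S → Γ → S) (l l' : List Γ) : ∀ s : S,
    stateTrace step s (l ++ l') =
      stateTrace step s l ++ stateTrace step (l.foldl step s) l' := by
  induction l with
  | nil => intro s; rfl
  | cons a l ih => intro s; simp [stateTrace, ih]

theorem length_stateTrace (step : S → Γ → S) (l : List Γ) : ∀ s : S,
    (stateTrace step s l).length = l.length := by
  induction l with
  | nil => intro s; rfl
  | cons a l ih => intro s; simp [stateTrace, ih]

theorem getElem_stateTrace (step : S → Γ → S) (l : List Γ) : ∀ (s : S) (i : ℕ)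
    (h : i < (stateTrace step s l).length) (h' : i < l.length),
    (stateTrace step s l)[i] = ((l.take i).foldl step s, l[i]) := by
  induction l with
  | nil => intro s i h h'; simp at h'
  | cons a l ih =>
    intro s i h h'
    cases i with
    | zero => simp [stateTrace]
    | succ i =>
      simp only [stateTrace, List.getElem_cons_succ, List.take_succ_cons, List.foldl_cons]
      exact ih _ _ _ (by simpa using h')

theorem driveState_eq_foldl {n : ℕ} (step : S → Γ → S) (s : S) (a : Fin n → Γ) (t : ℕ)
    (ht : t ≤ n) : driveState step s a t = ((List.ofFn a).take t).foldl step s := by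
  induction t with
  | zero => simp [driveState]
  | succ t ih =>
    have h : t < n := ht
    rw [driveState, dif_pos h, ih h.le, List.take_succ_eq_append_getElem (by simpa using h),
      List.foldl_append]
    simp

theorem stateTrace_ofFn {n : ℕ} (step : S → Γ → S) (s : S) (a : Fin n → Γ) :
    stateTrace step s (List.ofFn a) = List.ofFn fun t : Fin n => (driveState step s a t, a t) := by
  apply List.ext_getElem
  · simp [length_stateTrace]
  · intro i h h'
    have hi : i < n := by simpa using h'
    rw [getElem_stateTrace _ _ _ _ _ (by simpa using hi), List.getElem_ofFn, List.getElem_ofFn,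
      driveState_eq_foldl _ _ _ _ hi.le]

/-- The phrases of a parsing, each with the states at its beginning and at its end. -/
def annotate (step : S → Γ → S) : S → List (List Γ) → List (S × List Γ × S)
  | _, [] => []
  | s, p :: D => (s, p, p.foldl step s) :: annotate step (p.foldl step s) D

theorem map_annotate (step : S → Γ → S) (D : List (List Γ)) : ∀ s : S,
    (annotate step s D).map (fun e => e.2.1) = D := by
  induction D with
  | nil => intro s; rfl
  | cons p D ih => intro s; simp [annotate, ih]

theorem foldl_of_mem_annotate (step : S → Γ → S) (D : List (List Γ)) : ∀ s : S,
    ∀ e ∈ annotate step s D, e.2.2 = e.2.1.foldl step e.1 := by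
  induction D with
  | nil => intro s e he; simp [annotate] at he
  | cons p D ih =>
    intro s e he
    rcases List.mem_cons.1 he with rfl | he
    · rfl
    · exact ih _ e he

theorem stateTrace_flatten (step : S → Γ → S) (D : List (List Γ)) : ∀ s : S,
    stateTrace step s D.flatten =
      (annotate step s D).flatMap fun e => stateTrace step e.1 e.2.1 := by
  induction D with
  | nil => intro s; rfl
  | cons p D ih => intro s; simp [annotate, stateTrace_append, ih]

/-- Replacing phrases by phrases with the same initial and final states gives a path again. -/
theorem annotate_of_map_eq {K : Type*} (step : S → Γ → S) (k : List Γ → K) (D : List (List Γ)) :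
    ∀ (s : S) (L : List (S × List Γ × S)), (∀ e ∈ L, e.2.2 = e.2.1.foldl step e.1) →
      L.map (fun e => (e.1, k e.2.1, e.2.2)) =
        (annotate step s D).map (fun e => (e.1, k e.2.1, e.2.2)) →
      annotate step s (L.map fun e => e.2.1) = L ∧
        (L.map fun e => e.2.1).flatten.foldl step s = D.flatten.foldl step s := by
  induction D with
  | nil =>
    intro s L _ h
    have : L = [] := by simpa [annotate] using h
    subst this
    exact ⟨rfl, rfl⟩
  | cons p D ih =>
    intro s L hL h
    cases L with
    | nil => simp [annotate] at h
    | cons e L =>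
      obtain ⟨s', p', s''⟩ := e
      simp only [annotate, List.map_cons, List.cons.injEq, Prod.mk.injEq] at h
      obtain ⟨⟨rfl, -, h2⟩, h3⟩ := h
      have hv : s'' = p'.foldl step s' := hL _ List.mem_cons_self
      obtain ⟨h4, h5⟩ := ih (p.foldl step s') L (fun e he => hL e (List.mem_cons_of_mem _ he)) h3
      refine ⟨?_, ?_⟩
      · simp only [List.map_cons, annotate]
        rw [← hv, h2, h4]
      · simp only [List.map_cons, List.flatten_cons, List.foldl_append]
        rw [← hv, h2, h5]

theorem count_ofFn {A : Type*} [DecidableEq A] {n : ℕ} (f : Fin n → A) (b : A) :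
    (List.ofFn f).count b = Fintype.card {i // f i = b} := by
  rw [← Multiset.coe_count, List.ofFn_eq_map, ← Multiset.map_coe, Multiset.count_map,
    Fintype.card_subtype, Finset.card_def, Finset.filter_val]
  congr 1
  exact Multiset.filter_congr fun _ _ => eq_comm

/-- Fibres over each letter have equal size; bijections between them glue to a permutation of
positions. -/
theorem sameType_of_perm {A : Type*} {n : ℕ} {a a' : Fin n → A}
    (h : (List.ofFn a').Perm (List.ofFn a)) : SameType a a' := by
  let _ := Classical.decEq A
  have hcard : ∀ b, Fintype.card {i // a' i = b} = Fintype.card {i // a i = b} := fun b => by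
    rw [← count_ofFn, ← count_ofFn, h.count_eq b]
  let e := fun b => (Fintype.card_eq.1 (hcard b)).some
  let π : Equiv.Perm (Fin n) := (Equiv.sigmaFiberEquiv a').symm.trans
    ((Equiv.sigmaCongrRight e).trans (Equiv.sigmaFiberEquiv a))
  refine ⟨π, ?_⟩
  ext i
  exact ((e (a' i) ⟨i, rfl⟩).2).symm

/-- A product of factorials dominates the product of the class sizes of a partition that is
coarser by a bounded factor. -/
theorem prod_card_le_prod_factorial {ι K T : Type*} [Fintype ι] [DecidableEq ι] [DecidableEq K]
    [DecidableEq T] (f : ι → K) (h : K → T) (N : ℕ) (hN : 0 < N)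
    (hfib : ∀ t, ((Finset.univ.image f).filter fun k => h k = t).card ≤ N) :
    ∏ i, (Fintype.card {i' // h (f i') = h (f i)} : ℝ) ≤
      (N * Real.exp 1) ^ Fintype.card ι *
        ∏ k ∈ Finset.univ.image f, ((Fintype.card {i // f i = k}).factorial : ℝ) := by
  have hN' : (0 : ℝ) < N := by exact_mod_cast hN
  set m : T → ℝ := fun t => Fintype.card {i' // h (f i') = t} with hm
  -- The estimate used is `a ^ c ≤ exp a · c!` with `a = m / N`. Since at most `N` classes lie over
  -- each `t`, division by `N` keeps the sum of the exponents below `∑ m t = card ι`.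
  have h1 : ∏ i, (m (h (f i)) / N) ≤ Real.exp (Fintype.card ι) *
      ∏ k ∈ Finset.univ.image f, ((Fintype.card {i // f i = k}).factorial : ℝ) := by
    rw [← Finset.prod_fiberwise_of_maps_to (s := Finset.univ) (t := Finset.univ.image f) (g := f)
      (fun i _ => Finset.mem_image_of_mem f (Finset.mem_univ i))]
    calc _ = ∏ k ∈ Finset.univ.image f, (m (h k) / N) ^ Fintype.card {i // f i = k} := by
          refine Finset.prod_congr rfl fun k _ => ?_
          rw [Finset.prod_congr rfl (g := fun _ => m (h k) / N) fun i hi => by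
            rw [(Finset.mem_filter.1 hi).2], Finset.prod_const, Fintype.card_subtype]
      _ ≤ ∏ k ∈ Finset.univ.image f, (Real.exp (m (h k) / N) *
            ((Fintype.card {i // f i = k}).factorial : ℝ)) := by
          refine Finset.prod_le_prod (fun k _ => by positivity) fun k _ => ?_
          rw [← div_le_iff₀ (by positivity)]
          exact Real.pow_div_factorial_le_exp _ (by positivity) _
      _ ≤ _ := by
          rw [Finset.prod_mul_distrib, ← Real.exp_sum]
          refine mul_le_mul_of_nonneg_right (Real.exp_le_exp.2 ?_) (by positivity)
          rw [← Finset.sum_div, div_le_iff₀ hN', ← Finset.sum_fiberwise_of_maps_to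
            (t := Finset.univ.image (h ∘ f)) (g := h)]
          · calc _ ≤ ∑ t ∈ Finset.univ.image (h ∘ f), N * m t := by
                  refine Finset.sum_le_sum fun t _ => ?_
                  rw [Finset.sum_congr rfl (g := fun _ => m t) fun k hk => by
                    rw [(Finset.mem_filter.1 hk).2], Finset.sum_const, nsmul_eq_mul]
                  refine mul_le_mul_of_nonneg_right ?_ (by positivity)
                  exact_mod_cast hfib t
              _ = _ := by
                  rw [← Finset.mul_sum, mul_comm]
                  congr 1
                  have := Finset.card_eq_sum_card_fiberwise (s := (Finset.univ : Finset ι))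
                    (t := Finset.univ.image (h ∘ f)) (f := h ∘ f)
                    fun i _ => Finset.mem_image_of_mem _ (Finset.mem_univ i)
                  rw [← Finset.card_univ, this]
                  push_cast
                  refine Finset.sum_congr rfl fun t _ => ?_
                  simp only [hm, Fintype.card_subtype]
                  rfl
          · intro k hk
            obtain ⟨i, -, rfl⟩ := Finset.mem_image.1 hk
            exact Finset.mem_image_of_mem (h ∘ f) (Finset.mem_univ i)
  have h2 : ∏ i, (m (h (f i)) / N) = (∏ i, m (h (f i))) / (N : ℝ) ^ Fintype.card ι := by
    rw [Finset.prod_div_distrib, Finset.prod_const, Finset.card_univ]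
  rw [h2, div_le_iff₀ (by positivity)] at h1
  refine h1.trans (le_of_eq ?_)
  rw [mul_pow, ← Real.exp_nat_mul, mul_one]
  ring

theorem exists_eq_ofFn {A B : Type*} {n : ℕ} (l : List (A × B)) (y : Fin n → B)
    (h : l.map Prod.snd = List.ofFn y) : ∃ x : Fin n → A, l = List.ofFn fun t => (x t, y t) := by
  have hlen : l.length = n := by simpa using congrArg List.length h
  subst hlen
  refine ⟨fun t => (l.get t).1, ?_⟩
  apply List.ext_getElem (by simp)
  intro i h1 h2
  have h3 : (l.map Prod.snd)[i]'(by simpa using h1) = (List.ofFn y)[i]'(by simpa using h1) := by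
    simp only [h]
  rw [List.getElem_map, List.getElem_ofFn] at h3
  rw [List.getElem_ofFn, ← h3]
  rfl

open Classical in
/-- The sequences that, together with `y`, lead an automaton through a rearrangement of the
states and letters along `(x, y)`. -/
noncomputable def pathClass {A B : Type*} [Fintype A] {n : ℕ} (step : S → A × B → S) (s : S)
    (x : Fin n → A) (y : Fin n → B) : Finset (Fin n → A) :=
  Finset.univ.filter fun x' =>
    SameType (fun t : Fin n => (driveState step s (fun i => (x i, y i)) t, x t, y t))
      (fun t : Fin n => (driveState step s (fun i => (x' i, y i)) t, x' t, y t))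

theorem mem_pathClass {A B : Type*} [Fintype A] {n : ℕ} {step : S → A × B → S} {s : S}
    {x x' : Fin n → A} {y : Fin n → B} : x' ∈ pathClass step s x y ↔
      SameType (fun t : Fin n => (driveState step s (fun i => (x i, y i)) t, x t, y t))
        (fun t : Fin n => (driveState step s (fun i => (x' i, y i)) t, x' t, y t)) := by
  simp [pathClass]

theorem self_mem_pathClass {A B : Type*} [Fintype A] {n : ℕ} (step : S → A × B → S) (s : S)
    (x : Fin n → A) (y : Fin n → B) : x ∈ pathClass step s x y :=
  mem_pathClass.2 ⟨1, rfl⟩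

/-- Permutations of phrases with equal side phrase and equal end states give distinct members of the
class. There are `∏ m!` of them, `m` being the class sizes. Refining side phrases by two states
splits each into at most `|S|²` classes, which costs a bounded factor per phrase. -/
theorem lzWeight_le_card_pathClass {A B : Type*} [Fintype A] [DecidableEq A] [DecidableEq B]
    [Fintype S] {n : ℕ} (step : S → A × B → S) (s : S) (x : Fin n → A) (y : Fin n → B) :
    (lzWeight x y : ℝ) ≤
      (((Fintype.card S * Fintype.card S : ℕ) : ℝ) * Real.exp 1) ^ (jointPhrases x y).length *
        (pathClass step s x y).card := by
  classical
  obtain ⟨r, -, hr⟩ := exists_flatten_jointPhrases x y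
  have hnodup := (incremental_jointPhrases x y).nodup
  have hside : sideList x y = (jointPhrases x y).map (List.map Prod.snd) := rfl
  rw [lzWeight, hside]
  generalize jointPhrases x y = D at hr hnodup
  set L := annotate step s D with hL
  have hLD : L.map (fun e => e.2.1) = D := map_annotate step D s
  have hlen : L.length = D.length := by rw [← hLD, List.length_map]
  have hLget : List.ofFn L.get = L := List.ofFn_get L
  -- Equal side phrases keep `y` fixed under an exchange; equal end states keep the phrases
  -- traversed from the same states.
  let key : S × List (A × B) × S → S × List B × S := fun e => (e.1, e.2.1.map Prod.snd, e.2.2)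
  let f : Fin L.length → S × List B × S := fun i => key (L.get i)
  let G := {g : Equiv.Perm (Fin L.length) // f ∘ g = f}
  have hex : ∀ g : G, ∃ x' : Fin n → A,
      (List.ofFn fun i => (L.get (g.1 i)).2.1).flatten ++ r = List.ofFn (fun t => (x' t, y t)) ∧
      x' ∈ pathClass step s x y := by
    rintro ⟨g, hg⟩
    set L' := List.ofFn (fun i => L.get (g i)) with hL'
    have hD' : List.ofFn (fun i => (L.get (g i)).2.1) = L'.map fun e => e.2.1 := by
      rw [hL', List.map_ofFn]
      rfl
    have hkey : L'.map key = L.map key := by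
      conv_rhs => rw [← hLget]
      rw [hL', List.map_ofFn, List.map_ofFn]
      exact congrArg List.ofFn hg
    have hperm : L'.Perm L := by
      conv_rhs => rw [← hLget]
      exact Equiv.Perm.ofFn_comp_perm g L.get
    obtain ⟨h1, h2⟩ := annotate_of_map_eq step (List.map Prod.snd) D s L'
      (fun e he => foldl_of_mem_annotate step D s e (hperm.mem_iff.1 he)) hkey
    have hsnd : (L'.map fun e => e.2.1).map (List.map Prod.snd) = D.map (List.map Prod.snd) := by
      have := congrArg (List.map fun e : S × List B × S => e.2.1) hkey
      rw [List.map_map, List.map_map] at this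
      conv_rhs => rw [← hLD]
      rw [List.map_map, List.map_map]
      exact this
    simp only [hD']
    obtain ⟨x', hx'⟩ := exists_eq_ofFn ((L'.map fun e => e.2.1).flatten ++ r) y (by
      rw [List.map_append, List.map_flatten, hsnd, ← List.map_flatten, ← List.map_append, hr,
        List.map_ofFn]
      rfl)
    refine ⟨x', hx', mem_pathClass.2 (sameType_of_perm ?_)⟩
    have htr : (stateTrace step s (List.ofFn fun t => (x' t, y t))).Perm
        (stateTrace step s (List.ofFn fun t => (x t, y t))) := by
      rw [← hx', ← hr, stateTrace_append, stateTrace_append, h2]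
      refine List.Perm.append_right _ ?_
      rw [stateTrace_flatten, stateTrace_flatten, h1]
      exact hperm.flatMap_right _
    rwa [stateTrace_ofFn, stateTrace_ofFn] at htr
  choose F hF1 hF2 using hex
  -- Exchanged phrases have equal lengths, so the concatenation determines the list of phrases; as
  -- phrases are distinct, the list determines the permutation.
  have hinj : Function.Injective F := by
    intro g g' hgg
    have h1 : (List.ofFn fun i => (L.get (g.1 i)).2.1).flatten =
        (List.ofFn fun i => (L.get (g'.1 i)).2.1).flatten := by
      have := (hF1 g).trans ((congrArg (fun x' : Fin n → A =>
        List.ofFn fun t => (x' t, y t)) hgg).trans (hF1 g').symm)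
      exact List.append_cancel_right this
    have h2 : (List.ofFn fun i => (L.get (g.1 i)).2.1) =
        List.ofFn fun i => (L.get (g'.1 i)).2.1 := by
      refine List.eq_iff_flatten_eq.2 ⟨h1, ?_⟩
      rw [List.map_ofFn, List.map_ofFn]
      refine congrArg List.ofFn (funext fun i => ?_)
      have h3 : f (g.1 i) = f (g'.1 i) := (congrFun g.2 i).trans (congrFun g'.2 i).symm
      have h4 := congrArg (fun e : S × List B × S => e.2.1.length) h3
      simpa [f, key] using h4
    have h5 := List.ofFn_injective h2
    refine Subtype.ext (Equiv.ext fun i => ?_)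
    have h6 : (L.get (g.1 i)).2.1 = (L.get (g'.1 i)).2.1 := congrFun h5 i
    have h7 : (L.map fun e => e.2.1).Nodup := by rwa [hLD]
    apply Fin.ext
    have h8 := (List.Nodup.getElem_inj_iff h7 (i := (g.1 i : ℕ)) (j := (g'.1 i : ℕ))
      (hi := by simp) (hj := by simp)).1
    apply h8
    rw [List.getElem_map, List.getElem_map]
    exact h6
  have hcard : (Fintype.card G : ℝ) ≤ (pathClass step s x y).card := by
    rw [← Finset.card_univ, ← Finset.card_image_of_injective Finset.univ hinj]
    refine Nat.cast_le.2 (Finset.card_le_card fun x' hx' => ?_)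
    obtain ⟨g, -, rfl⟩ := Finset.mem_image.1 hx'
    exact hF2 g
  have hG : Fintype.card G = ∏ k ∈ Finset.univ.image f,
      (Fintype.card {i // f i = k}).factorial := by
    rw [← DomMulAct.stabilizer_card' f]
  have hself : (selfCount (D.map (List.map Prod.snd)) : ℝ) =
      ∏ i, (Fintype.card {i' // (f i').2.1 = (f i).2.1} : ℝ) := by
    have h1 : D.map (List.map Prod.snd) = List.ofFn fun i => (f i).2.1 := by
      have h2 := congrArg (List.map fun e : S × List (A × B) × S => e.2.1.map Prod.snd) hLget
      rw [List.map_ofFn] at h2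
      rw [← hLD, List.map_map]
      exact h2.symm
    rw [h1, selfCount, List.map_ofFn, List.prod_ofFn]
    push_cast
    refine Finset.prod_congr rfl fun i _ => ?_
    rw [Function.comp_apply, count_ofFn]
  have hS : 0 < Fintype.card S := Fintype.card_pos_iff.2 ⟨s⟩
  have hmain := prod_card_le_prod_factorial f (fun k => k.2.1) (Fintype.card S * Fintype.card S)
    (Nat.mul_pos hS hS) (fun w => by
      rw [← Fintype.card_prod, ← Finset.card_univ]
      refine Finset.card_le_card_of_injOn (fun k => (k.1, k.2.2))
        (fun _ _ => Finset.mem_coe.2 (Finset.mem_univ _)) ?_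
      rintro ⟨a, b, c⟩ h1 ⟨a', b', c'⟩ h2 h3
      have h1 := (Finset.mem_filter.1 (Finset.mem_coe.1 h1)).2
      have h2 := (Finset.mem_filter.1 (Finset.mem_coe.1 h2)).2
      simp_all)
  rw [hself]
  refine hmain.trans ?_
  rw [Fintype.card_fin, ← hlen]
  refine mul_le_mul_of_nonneg_left ?_ (by positivity)
  refine le_trans (le_of_eq ?_) hcard
  rw [hG]
  push_cast
  rfl

theorem eventually_lzWeight_le_card_pathClass (A B : Type*) [Fintype A] [DecidableEq A]
    [DecidableEq B] [Finite B] [Finite S] {ε : ℝ} (hε : 0 < ε) :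
    ∀ᶠ n : ℕ in atTop, ∀ (step : S → A × B → S) (s : S) (x : Fin n → A) (y : Fin n → B),
      (lzWeight x y : ℝ) ≤ Real.exp (ε * n) * (pathClass step s x y).card := by
  cases nonempty_fintype S
  set K : ℝ := ((Fintype.card S * Fintype.card S : ℕ) : ℝ) * Real.exp 1 with hK
  have hK0 : 0 ≤ K := by positivity
  filter_upwards [eventually_length_jointPhrases_le A B (δ := ε / (K + 1)) (by positivity)]
    with n hn step s x y
  refine (lzWeight_le_card_pathClass step s x y).trans
    (mul_le_mul_of_nonneg_right ?_ (by positivity))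
  calc K ^ (jointPhrases x y).length
      ≤ Real.exp (K + 1) ^ (jointPhrases x y).length :=
        pow_le_pow_left₀ hK0 (by linarith [Real.add_one_le_exp (K + 1)]) _
    _ ≤ Real.exp (ε * n) := by
        rw [← Real.exp_nat_mul]
        refine Real.exp_le_exp.2 ?_
        have h := mul_le_mul_of_nonneg_right (hn x y) (by positivity : 0 ≤ K + 1)
        refine h.trans (le_of_eq ?_)
        field_simp

end Rearrangement

/-! ### Random binning and random codebooks -/

section RandomCoding

/-- Independence: the expectation of a product of functions of distinct coordinates factors. -/
theorem sum_prod_mul_prod {ι A : Type*} [Fintype ι] [DecidableEq ι] [Fintype A] {p : A → ℝ}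
    (hp : ∑ a, p a = 1) (s : Finset ι) (ψ : ι → A → ℝ) :
    ∑ f : ι → A, (∏ i, p (f i)) * ∏ i ∈ s, ψ i (f i) = ∏ i ∈ s, ∑ a, p a * ψ i a := by
  have h1 : ∀ g : ι → ℝ, ∏ i ∈ s, g i = ∏ i, if i ∈ s then g i else 1 := fun g => by
    rw [Finset.prod_ite_mem, Finset.univ_inter]
  simp_rw [h1, ← Finset.prod_mul_distrib]
  rw [← Fintype.prod_sum (fun i a => p a * if i ∈ s then ψ i a else 1)]
  refine Finset.prod_congr rfl fun i _ => ?_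
  by_cases hi : i ∈ s <;> simp [hi, hp]

theorem sum_prod_mul_one {ι A : Type*} [Fintype ι] [DecidableEq ι] [Fintype A] {p : A → ℝ}
    (hp : ∑ a, p a = 1) (i : ι) (φ : A → ℝ) :
    ∑ f : ι → A, (∏ i, p (f i)) * φ (f i) = ∑ a, p a * φ a := by
  simpa using sum_prod_mul_prod hp {i} fun _ => φ

theorem sum_prod_mul_two {ι A : Type*} [Fintype ι] [DecidableEq ι] [Fintype A] {p : A → ℝ}
    (hp : ∑ a, p a = 1) {i j : ι} (hij : i ≠ j) (φ ψ : A → ℝ) :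
    ∑ f : ι → A, (∏ i, p (f i)) * (φ (f i) * ψ (f j)) =
      (∑ a, p a * φ a) * ∑ a, p a * ψ a := by
  have := sum_prod_mul_prod hp {i, j} fun k => if k = i then φ else ψ
  simpa [Finset.prod_pair hij, hij.symm] using this

theorem sum_prod_mul_three {ι A : Type*} [Fintype ι] [DecidableEq ι] [Fintype A] {p : A → ℝ}
    (hp : ∑ a, p a = 1) {i j k : ι} (hij : i ≠ j) (hik : i ≠ k) (hjk : j ≠ k)
    (φ ψ χ : A → ℝ) :
    ∑ f : ι → A, (∏ i, p (f i)) * (φ (f i) * (ψ (f j) * χ (f k))) =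
      (∑ a, p a * φ a) * ((∑ a, p a * ψ a) * ∑ a, p a * χ a) := by
  have := sum_prod_mul_prod hp {i, j, k} fun l => if l = i then φ else if l = j then ψ else χ
  rw [Finset.prod_insert (by simp [hij, hik]), Finset.prod_pair hjk] at this
  simp_rw [Finset.prod_insert (show i ∉ ({j, k} : Finset ι) by simp [hij, hik]),
    Finset.prod_pair hjk] at this
  simpa [hij.symm, hik.symm, hjk.symm] using this

/-- The event that the source vector `i` is in bin `j`, whose codeword is `x`. -/
def sent {I A : Type*} [DecidableEq A] {M : ℕ} (i : I) (j : Fin M) (x : A) (f : I → Fin M)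
    (C : Fin M → A) : ℝ :=
  (if f i = j then 1 else 0) * (if C j = x then 1 else 0)

theorem sent_nonneg {I A : Type*} [DecidableEq A] {M : ℕ} (i : I) (j : Fin M) (x : A)
    (f : I → Fin M) (C : Fin M → A) : 0 ≤ sent i j x f C := by
  unfold sent
  positivity

theorem sum_uniform {M : ℕ} (hM : 0 < M) : ∑ _j : Fin M, (1 / (M : ℝ)) = 1 := by
  have : (M : ℝ) ≠ 0 := by positivity
  simp [this]

variable {I A : Type*} [Fintype I] [DecidableEq I] [Fintype A] {M : ℕ}

/-- The average over uniform random binnings and random codebooks. -/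
noncomputable def codeMean (q : A → ℝ) (F : (I → Fin M) → (Fin M → A) → ℝ) : ℝ :=
  ∑ f : I → Fin M, ∑ C : Fin M → A, (∏ _i : I, (1 / (M : ℝ))) * (∏ j, q (C j)) * F f C

/-- Codebooks containing a word of probability zero carry no weight. Excluding them matters for the
universal metric, where `Real.logb 2 0 = 0` is a junk value. -/
theorem codeMean_mono {q : A → ℝ} (hq : ∀ a, 0 ≤ q a) {F G : (I → Fin M) → (Fin M → A) → ℝ}
    (h : ∀ f C, (∀ j, 0 < q (C j)) → F f C ≤ G f C) : codeMean q F ≤ codeMean q G := by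
  refine Finset.sum_le_sum fun f _ => Finset.sum_le_sum fun C _ => ?_
  by_cases hC : ∀ j, 0 < q (C j)
  · exact mul_le_mul_of_nonneg_left (h f C hC)
      (mul_nonneg (Finset.prod_nonneg fun _ _ => by positivity)
        (Finset.prod_nonneg fun j _ => hq _))
  · push Not at hC
    obtain ⟨j, hj⟩ := hC
    rw [Finset.prod_eq_zero (Finset.mem_univ j) (le_antisymm hj (hq _))]
    simp

theorem codeMean_sum {T : Type*} (q : A → ℝ) (s : Finset T)
    (F : T → (I → Fin M) → (Fin M → A) → ℝ) :
    codeMean q (fun f C => ∑ t ∈ s, F t f C) = ∑ t ∈ s, codeMean q (F t) := by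
  unfold codeMean
  simp_rw [Finset.mul_sum]
  conv_rhs => rw [Finset.sum_comm]
  refine Finset.sum_congr rfl fun f _ => ?_
  conv_rhs => rw [Finset.sum_comm]

theorem codeMean_mul (q : A → ℝ) (c : ℝ) (F : (I → Fin M) → (Fin M → A) → ℝ) :
    codeMean q (fun f C => c * F f C) = c * codeMean q F := by
  unfold codeMean
  simp_rw [Finset.mul_sum]
  exact Finset.sum_congr rfl fun f _ => Finset.sum_congr rfl fun C _ => by ring

theorem codeMean_sub (q : A → ℝ) (F G : (I → Fin M) → (Fin M → A) → ℝ) :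
    codeMean q (fun f C => F f C - G f C) = codeMean q F - codeMean q G := by
  unfold codeMean
  simp_rw [mul_sub, Finset.sum_sub_distrib]

theorem codeMean_eq (q : A → ℝ) (F : (I → Fin M) → (Fin M → A) → ℝ) :
    codeMean q F = ∑ f : I → Fin M, (∏ _i : I, (1 / (M : ℝ))) *
      ∑ C : Fin M → A, (∏ j, q (C j)) * F f C := by
  unfold codeMean
  simp_rw [Finset.mul_sum, mul_assoc]

variable [DecidableEq A]

theorem sum_codebook_one {q : A → ℝ} (hq : ∑ a, q a = 1) (j k : Fin M) (x : A) (h : A → ℝ) :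
    ∑ C : Fin M → A, (∏ j, q (C j)) * ((if C j = x then 1 else 0) * h (C k)) =
      q x * if k = j then h x else ∑ a, q a * h a := by
  by_cases hkj : k = j
  · subst hkj
    have := sum_prod_mul_one hq k fun a => (if a = x then 1 else 0) * h a
    rw [this, if_pos rfl]
    simp
  · rw [sum_prod_mul_two hq (Ne.symm hkj) (fun a => if a = x then 1 else 0) h, if_neg hkj]
    simp

/-- With probability `1 / M` the vector `i'` shares the bin of `i` and hence the codeword `x`;
otherwise its codeword is a fresh draw from `q`. -/
theorem codeMean_sent_mul {q : A → ℝ} (hq : ∑ a, q a = 1) (hM : 0 < M) {i i' : I} (hi : i ≠ i')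
    (j : Fin M) (x : A) (h : A → ℝ) :
    codeMean q (fun f C => sent i j x f C * h (C (f i'))) =
      q x / M * ((h x + (M - 1) * ∑ a, q a * h a) / M) := by
  rw [codeMean_eq]
  have h1 : ∀ f : I → Fin M, ∑ C : Fin M → A, (∏ j, q (C j)) * (sent i j x f C * h (C (f i'))) =
      (if f i = j then 1 else 0) * (q x * if f i' = j then h x else ∑ a, q a * h a) := by
    intro f
    rw [← sum_codebook_one hq, Finset.mul_sum]
    exact Finset.sum_congr rfl fun C _ => by unfold sent; ring
  simp_rw [h1]
  rw [sum_prod_mul_two (p := fun _ : Fin M => 1 / (M : ℝ)) (sum_uniform hM) hi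
    (fun k => if k = j then 1 else 0) (fun k => q x * if k = j then h x else ∑ a, q a * h a)]
  rw [← Finset.mul_sum, ← Finset.mul_sum, ← Finset.mul_sum, Finset.sum_ite_eq',
    if_pos (Finset.mem_univ _)]
  have h2 : ∑ k : Fin M, (if k = j then h x else ∑ a, q a * h a) =
      h x + (M - 1) * ∑ a, q a * h a := by
    rw [← Finset.add_sum_erase _ _ (Finset.mem_univ j), if_pos rfl,
      Finset.sum_congr rfl (g := fun _ => ∑ a, q a * h a)
        fun k hk => if_neg (Finset.ne_of_mem_erase hk), Finset.sum_const,
      Finset.card_erase_of_mem (Finset.mem_univ j), Finset.card_univ, Fintype.card_fin,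
      nsmul_eq_mul, Nat.cast_sub hM, Nat.cast_one]
  rw [h2]
  ring

theorem codeMean_sent {q : A → ℝ} (hq : ∑ a, q a = 1) (hM : 0 < M) (i : I) (j : Fin M) (x : A) :
    codeMean q (fun f C => sent i j x f C) = q x / M := by
  rw [codeMean_eq]
  have h1 : ∀ f : I → Fin M, ∑ C : Fin M → A, (∏ j, q (C j)) * sent i j x f C =
      (if f i = j then 1 else 0) * q x := by
    intro f
    have := sum_codebook_one hq j j x fun _ => 1
    rw [if_pos rfl, mul_one] at this
    rw [← this, Finset.mul_sum]
    exact Finset.sum_congr rfl fun C _ => by unfold sent; ring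
  simp_rw [h1]
  rw [sum_prod_mul_one (p := fun _ : Fin M => 1 / (M : ℝ)) (sum_uniform hM) i
    (fun k => (if k = j then 1 else 0) * q x)]
  simp
  ring

/-- Given `C j = x ∈ T`, the two membership events are independent unless `k = l`, when they
coincide; the last summand pays for that collision. -/
theorem sum_codebook_two_le {q : A → ℝ} (hq : IsDistribution q) (j k l : Fin M) {x : A}
    {T : Finset A} (hx : x ∈ T) :
    ∑ C : Fin M → A, (∏ j, q (C j)) * ((if C j = x then 1 else 0) *
        ((if C k ∈ T then 1 else 0) * if C l ∈ T then 1 else 0)) ≤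
      q x * ((if k = j then 1 else ∑ a ∈ T, q a) * (if l = j then 1 else ∑ a ∈ T, q a) +
        if k = l then (if k = j then 1 else ∑ a ∈ T, q a) else 0) := by
  have hT : ∑ a, q a * (if a ∈ T then 1 else 0) = ∑ a ∈ T, q a := by simp
  have hT0 : 0 ≤ ∑ a ∈ T, q a := Finset.sum_nonneg fun a _ => hq.1 a
  have hsingle : ∀ k : Fin M, ∑ C : Fin M → A, (∏ j, q (C j)) * ((if C j = x then 1 else 0) *
      (if C k ∈ T then 1 else 0)) = q x * if k = j then 1 else ∑ a ∈ T, q a := by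
    intro k
    rw [sum_codebook_one hq.2 j k x fun a => if a ∈ T then 1 else 0, hT, if_pos hx]
  have hsent : ∀ a : A, (if a = x then (1 : ℝ) else 0) * (if a ∈ T then 1 else 0) =
      if a = x then 1 else 0 := by
    intro a
    by_cases h : a = x
    · simp [h, hx]
    · simp [h]
  by_cases hkl : k = l
  · subst hkl
    rw [if_pos rfl, mul_add, ← hsingle k]
    refine le_trans (le_of_eq ?_) (le_add_of_nonneg_left ?_)
    · refine Finset.sum_congr rfl fun C _ => ?_
      by_cases h : C k ∈ T <;> simp [h]
    · have := hq.1 x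
      positivity
  rw [if_neg hkl, add_zero]
  by_cases hkj : k = j
  · subst hkj
    rw [if_pos rfl, one_mul, ← hsingle l]
    exact le_of_eq (Finset.sum_congr rfl fun C _ => by rw [← mul_assoc (ite _ _ _), hsent])
  by_cases hlj : l = j
  · subst hlj
    rw [if_pos rfl, mul_one, ← hsingle k]
    refine le_of_eq (Finset.sum_congr rfl fun C _ => ?_)
    rw [mul_comm (if C k ∈ T then (1 : ℝ) else 0), ← mul_assoc (ite _ _ _), hsent]
  rw [if_neg hkj, if_neg hlj, sum_prod_mul_three hq.2 (Ne.symm hkj) (Ne.symm hlj) hkl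
    (fun a => if a = x then 1 else 0) (fun a => if a ∈ T then 1 else 0)
    (fun a => if a ∈ T then 1 else 0), hT]
  simp

/-- Near pairwise independence for the second moment: the extra term is the event that `i'` and
`i''` share a bin, of probability `1 / M`. -/
theorem codeMean_sent_mul_two_le {q : A → ℝ} (hq : IsDistribution q) (hM : 0 < M) {i i' i'' : I}
    (h1 : i ≠ i') (h2 : i ≠ i'') (h3 : i' ≠ i'') (j : Fin M) {x : A} {T : Finset A} (hx : x ∈ T) :
    codeMean q (fun f C => sent i j x f C *
        ((if C (f i') ∈ T then 1 else 0) * if C (f i'') ∈ T then 1 else 0)) ≤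
      q x / M * (((1 + (M - 1) * ∑ a ∈ T, q a) / M) ^ 2 +
        (1 + (M - 1) * ∑ a ∈ T, q a) / M / M) := by
  set φ : Fin M → ℝ := fun k => if k = j then 1 else ∑ a ∈ T, q a with hφ
  have hsum : ∑ k, φ k = 1 + (M - 1) * ∑ a ∈ T, q a := by
    rw [← Finset.add_sum_erase _ _ (Finset.mem_univ j), hφ]
    simp only [if_true]
    rw [Finset.sum_congr rfl (g := fun _ => ∑ a ∈ T, q a)
        fun k hk => if_neg (Finset.ne_of_mem_erase hk), Finset.sum_const,
      Finset.card_erase_of_mem (Finset.mem_univ j), Finset.card_univ, Fintype.card_fin,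
      nsmul_eq_mul, Nat.cast_sub hM, Nat.cast_one]
  rw [← hsum, codeMean_eq]
  have hC : ∀ f : I → Fin M, ∑ C : Fin M → A, (∏ j, q (C j)) * (sent i j x f C *
        ((if C (f i') ∈ T then 1 else 0) * if C (f i'') ∈ T then 1 else 0)) ≤
      q x * ((if f i = j then 1 else 0) * (φ (f i') * φ (f i'')) +
        ∑ l, (if f i = j then 1 else 0) *
          ((if f i' = l then φ l else 0) * if f i'' = l then 1 else 0)) := by
    intro f
    have h := mul_le_mul_of_nonneg_left (sum_codebook_two_le hq j (f i') (f i'') hx)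
      (by positivity : (0 : ℝ) ≤ if f i = j then 1 else 0)
    refine (le_of_eq ?_).trans (h.trans (le_of_eq ?_))
    · rw [Finset.mul_sum]
      exact Finset.sum_congr rfl fun C _ => by unfold sent; ring
    · rw [← Finset.mul_sum]
      have : ∑ l, ((if f i' = l then φ l else 0) * if f i'' = l then (1 : ℝ) else 0) =
          if f i' = f i'' then φ (f i') else 0 := by
        simp_rw [ite_mul, zero_mul]
        rw [Finset.sum_ite_eq, if_pos (Finset.mem_univ _)]
        by_cases h : f i' = f i''
        · simp [h]
        · simp [h, Ne.symm h]
      rw [this]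
      ring
  refine (Finset.sum_le_sum fun f _ => mul_le_mul_of_nonneg_left (hC f)
    (Finset.prod_nonneg fun _ _ => by positivity)).trans (le_of_eq ?_)
  have hu := sum_uniform hM
  have e1 : ∑ f : I → Fin M, (∏ _i : I, (1 / (M : ℝ))) *
      ((if f i = j then 1 else 0) * (φ (f i') * φ (f i''))) =
        1 / M * ((∑ k, φ k) / M * ((∑ k, φ k) / M)) := by
    rw [sum_prod_mul_three (p := fun _ : Fin M => 1 / (M : ℝ)) hu h1 h2 h3
      (fun k => if k = j then 1 else 0) φ φ]
    rw [← Finset.mul_sum, ← Finset.mul_sum, Finset.sum_ite_eq', if_pos (Finset.mem_univ _)]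
    ring
  have e2 : ∀ l, ∑ f : I → Fin M, (∏ _i : I, (1 / (M : ℝ))) *
      ((if f i = j then 1 else 0) *
          ((if f i' = l then φ l else 0) * if f i'' = l then 1 else 0)) =
        1 / M * (φ l / M * (1 / M)) := by
    intro l
    rw [sum_prod_mul_three (p := fun _ : Fin M => 1 / (M : ℝ)) hu h1 h2 h3
      (fun k => if k = j then 1 else 0) (fun k => if k = l then φ l else 0)
      (fun k => if k = l then 1 else 0)]
    rw [← Finset.mul_sum, ← Finset.mul_sum, ← Finset.mul_sum, Finset.sum_ite_eq',
      Finset.sum_ite_eq', Finset.sum_ite_eq', if_pos (Finset.mem_univ _),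
      if_pos (Finset.mem_univ _), if_pos (Finset.mem_univ _)]
    ring
  have e3 : ∀ f : I → Fin M, (∏ _i : I, (1 / (M : ℝ))) *
      (q x * ((if f i = j then 1 else 0) * (φ (f i') * φ (f i'')) +
        ∑ l, (if f i = j then 1 else 0) *
          ((if f i' = l then φ l else 0) * if f i'' = l then 1 else 0))) =
      q x * ((∏ _i : I, (1 / (M : ℝ))) * ((if f i = j then 1 else 0) * (φ (f i') * φ (f i''))) +
        ∑ l, (∏ _i : I, (1 / (M : ℝ))) * ((if f i = j then 1 else 0) *
          ((if f i' = l then φ l else 0) * if f i'' = l then 1 else 0))) := by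
    intro f
    simp only [Finset.mul_sum, mul_add]
    congr 1
    · ring
    · exact Finset.sum_congr rfl fun l _ => by ring
  simp_rw [e3]
  rw [← Finset.mul_sum, Finset.sum_add_distrib, e1, Finset.sum_comm]
  simp_rw [e2]
  rw [← Finset.mul_sum, ← Finset.sum_mul, ← Finset.sum_div]
  ring

end RandomCoding

/-! ### Matching union and second-moment bounds for competitors -/

section RandomCoding

variable {I A : Type*} [Fintype I] [DecidableEq I] [Fintype A] [DecidableEq A] {M : ℕ}

open Classical in
/-- The union bound. -/
theorem codeMean_sent_exists_le {q : A → ℝ} (hq : IsDistribution q) (hM : 0 < M) (i : I)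
    (j : Fin M) {x : A} (hx : 0 < q x) {α : I → ℝ} {β : A → ℝ} (hα : ∀ i, 0 < α i)
    (hβ : ∀ a, 0 < β a) {K : ℝ} (hK1 : 1 ≤ K) (hKα : ∑ i, 1 / α i ≤ K) (hKβ : ∑ a, 1 / β a ≤ K) :
    codeMean q (fun f C => sent i j x f C *
        if ∃ i' ≠ i, q (C (f i')) * β (C (f i')) * α i' ≤ q x * β x * α i then 1 else 0) ≤
      q x / M * (K ^ 2 * α i * (1 / M + q x * β x)) := by
  have hM' : (1 : ℝ) ≤ M := by exact_mod_cast hM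
  set h : I → A → ℝ := fun i' a => if q a * β a * α i' ≤ q x * β x * α i then 1 else 0 with hh
  have hterm : ∀ i' ∈ Finset.univ.erase i, codeMean q (fun f C => sent i j x f C *
      h i' (C (f i'))) ≤ q x / M * (α i * (1 / M + q x * β x * K)) * (1 / α i') := by
    intro i' hi'
    rw [codeMean_sent_mul hq.2 hM (Finset.ne_of_mem_erase hi').symm, mul_assoc (q x / M)]
    refine mul_le_mul_of_nonneg_left ?_ (by positivity)
    -- Here `i'` shares the codeword `x`, and the test reduces to `α i' ≤ α i`. For a fresh
    -- codeword, `h2` bounds the indicator by the ratio of the two products, and the factor `q a`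
    -- cancels. This leaves the Kraft sum over `β`.
    have h1 : h i' x ≤ α i * (1 / α i') := by
      rw [mul_one_div]
      by_cases hc : q x * β x * α i' ≤ q x * β x * α i
      · have := le_of_mul_le_mul_left hc (mul_pos hx (hβ x))
        simp only [hh, hc, if_true]
        rwa [le_div_iff₀ (hα i'), one_mul]
      · simp only [hh, hc, if_false]
        exact div_nonneg (hα i).le (hα i').le
    have h2 : ∑ a, q a * h i' a ≤ q x * β x * α i * (1 / α i') * K := by
      refine le_trans ?_ (mul_le_mul_of_nonneg_left hKβ ?_)
      · rw [Finset.mul_sum]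
        refine Finset.sum_le_sum fun a _ => ?_
        rw [mul_one_div, mul_one_div, div_div, le_div_iff₀ (mul_pos (hα i') (hβ a))]
        by_cases hc : q a * β a * α i' ≤ q x * β x * α i
        · simp only [hh, hc, if_true]
          linarith
        · simp only [hh, hc, if_false, mul_zero, zero_mul]
          exact mul_nonneg (mul_nonneg hx.le (hβ x).le) (hα i).le
      · have := hα i; have := hα i'; have := hβ x
        positivity
    have h3 : 0 ≤ ∑ a, q a * h i' a := Finset.sum_nonneg fun a _ =>
      mul_nonneg (hq.1 a) (by simp only [hh]; positivity)
    have h4 : (M - 1) * ∑ a, q a * h i' a ≤ M * (q x * β x * α i * (1 / α i') * K) :=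
      mul_le_mul (by linarith) h2 h3 (by positivity)
    rw [div_le_iff₀ (by positivity)]
    refine (add_le_add h1 h4).trans (le_of_eq ?_)
    field_simp
  have hsum : codeMean q (fun f C => sent i j x f C *
        if ∃ i' ≠ i, q (C (f i')) * β (C (f i')) * α i' ≤ q x * β x * α i then 1 else 0) ≤
      ∑ i' ∈ Finset.univ.erase i, codeMean q (fun f C => sent i j x f C * h i' (C (f i'))) := by
    rw [← codeMean_sum]
    refine codeMean_mono hq.1 fun f C _ => ?_
    rw [← Finset.mul_sum]
    refine mul_le_mul_of_nonneg_left ?_ (sent_nonneg i j x f C)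
    have hnn : ∀ i' ∈ Finset.univ.erase i, 0 ≤ h i' (C (f i')) := fun i' _ => by
      simp only [hh]; positivity
    split_ifs with hex
    · obtain ⟨i', hne, hc⟩ := hex
      refine le_trans (le_of_eq ?_)
        (Finset.single_le_sum hnn (Finset.mem_erase.2 ⟨hne, Finset.mem_univ i'⟩))
      simp only [hh, hc, if_true]
    · exact Finset.sum_nonneg hnn
  refine hsum.trans ((Finset.sum_le_sum hterm).trans ?_)
  rw [← Finset.mul_sum, mul_assoc (q x / M)]
  refine mul_le_mul_of_nonneg_left ?_ (by positivity)
  have hKα' : ∑ i' ∈ Finset.univ.erase i, 1 / α i' ≤ K :=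
    (Finset.sum_le_sum_of_subset_of_nonneg (Finset.erase_subset _ _)
      fun i' _ _ => (one_div_pos.2 (hα i')).le).trans hKα
  have hb := hβ x
  have ha := hα i
  calc α i * (1 / M + q x * β x * K) * ∑ i' ∈ Finset.univ.erase i, 1 / α i'
      ≤ α i * (1 / M * K + q x * β x * K) * K := by
        refine mul_le_mul ?_ hKα' (Finset.sum_nonneg fun i' _ => (one_div_pos.2 (hα i')).le)
          (by positivity)
        refine mul_le_mul_of_nonneg_left ?_ ha.le
        have : 1 / (M : ℝ) * 1 ≤ 1 / M * K := mul_le_mul_of_nonneg_left hK1 (by positivity)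
        linarith
    _ = _ := by ring

open Classical in
/-- The second-moment method. -/
theorem le_codeMean_sent_exists {q : A → ℝ} (hq : IsDistribution q) (hM : 0 < M) {i : I}
    (j : Fin M) {x : A} {N : Finset I} (hi : i ∉ N) {T : Finset A} (hx : x ∈ T) :
    q x / M * (1 / 3 * min 1 (N.card * ((1 + (M - 1) * ∑ a ∈ T, q a) / M))) ≤
      codeMean q (fun f C => sent i j x f C * if ∃ i' ∈ N, C (f i') ∈ T then 1 else 0) := by
  have hM' : (1 : ℝ) ≤ M := by exact_mod_cast hM
  have hT0 : 0 ≤ ∑ a ∈ T, q a := Finset.sum_nonneg fun a _ => hq.1 a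
  set p : ℝ := (1 + (M - 1) * ∑ a ∈ T, q a) / M with hp
  have hp0 : 0 ≤ p := div_nonneg (by nlinarith) (by linarith)
  have hpM : 1 / (M : ℝ) ≤ p := by
    rw [hp]
    gcongr
    nlinarith
  have hw : 0 ≤ q x / M := div_nonneg (hq.1 x) (by linarith)
  set w := q x / M
  set χ : I → (I → Fin M) → (Fin M → A) → ℝ := fun i' f C => if C (f i') ∈ T then 1 else 0 with hχ
  have hne : ∀ i' ∈ N, i ≠ i' := fun i' h e => hi (e ▸ h)
  have hfirst : ∀ i' ∈ N, codeMean q (fun f C => sent i j x f C * χ i' f C) = w * p := by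
    intro i' hi'
    have := codeMean_sent_mul hq.2 hM (hne i' hi') j x fun a => if a ∈ T then 1 else 0
    rw [if_pos hx] at this
    simpa [hχ] using this
  have hsecond : ∀ i' ∈ N, ∑ i'' ∈ N,
      codeMean q (fun f C => sent i j x f C * (χ i' f C * χ i'' f C)) ≤
        w * p + N.card * (w * (2 * p ^ 2)) := by
    intro i' hi'
    rw [← Finset.add_sum_erase _ _ hi']
    refine add_le_add (le_of_eq ?_) ?_
    · rw [← hfirst i' hi']
      congr 1
      ext f C
      by_cases h : C (f i') ∈ T <;> simp [hχ, h]
    · refine (Finset.sum_le_card_nsmul _ _ (w * (2 * p ^ 2)) fun i'' hi'' => ?_).trans ?_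
      · obtain ⟨h1, h2⟩ := Finset.mem_erase.1 hi''
        refine (codeMean_sent_mul_two_le hq hM (hne i' hi') (hne i'' h2) h1.symm j hx).trans ?_
        refine mul_le_mul_of_nonneg_left ?_ hw
        have : p / M ≤ p * p := by
          rw [div_eq_mul_one_div]
          exact mul_le_mul_of_nonneg_left hpM hp0
        rw [← hp]
        linarith
      · rw [nsmul_eq_mul]
        refine mul_le_mul_of_nonneg_right ?_ (by positivity)
        exact_mod_cast Finset.card_erase_le
  set m : ℝ := N.card * p with hm
  have hm0 : 0 ≤ m := by positivity
  -- With `Z` the number of competitors, `1{Z > 0} ≥ 2 t Z - t² Z²` because `(1 - t Z)² ≥ 0`. The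
  -- first moment is `m` and the second at most `m + 2 m²`; this `t` maximizes the resulting bound,
  -- with value `m / (1 + 2 m) ≥ min 1 m / 3`.
  set t : ℝ := 1 / (1 + 2 * m) with ht
  have hlower : 2 * t * (w * m) - t ^ 2 * (w * (m + 2 * m ^ 2)) ≤
      codeMean q (fun f C => sent i j x f C * if ∃ i' ∈ N, C (f i') ∈ T then 1 else 0) := by
    have hE1 : codeMean q (fun f C => 2 * t * ∑ i' ∈ N, sent i j x f C * χ i' f C) =
        2 * t * (w * m) := by
      rw [codeMean_mul, codeMean_sum, Finset.sum_congr rfl hfirst, Finset.sum_const,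
        nsmul_eq_mul, hm]
      ring
    have hE2 : codeMean q (fun f C => t ^ 2 * ∑ i' ∈ N, ∑ i'' ∈ N,
        sent i j x f C * (χ i' f C * χ i'' f C)) ≤ t ^ 2 * (w * (m + 2 * m ^ 2)) := by
      rw [codeMean_mul, codeMean_sum]
      refine mul_le_mul_of_nonneg_left ?_ (by positivity)
      simp_rw [codeMean_sum]
      refine (Finset.sum_le_card_nsmul _ _ _ hsecond).trans (le_of_eq ?_)
      rw [nsmul_eq_mul, hm]
      ring
    refine (sub_le_sub hE1.ge hE2).trans ?_
    rw [← codeMean_sub]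
    refine codeMean_mono hq.1 fun f C _ => ?_
    simp_rw [← Finset.mul_sum]
    rw [← Finset.sum_mul]
    set Z := ∑ i' ∈ N, χ i' f C with hZ
    have hs := sent_nonneg i j x f C
    split_ifs with hex
    · nlinarith [mul_nonneg hs (sq_nonneg (1 - t * Z))]
    · have : Z = 0 := Finset.sum_eq_zero fun i' hi' => by
        simp only [hχ]
        exact if_neg fun h => hex ⟨i', hi', h⟩
      simp [this]
  refine le_trans ?_ hlower
  have hval : 2 * t * (w * m) - t ^ 2 * (w * (m + 2 * m ^ 2)) = w * (m / (1 + 2 * m)) := by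
    rw [ht]
    field_simp
    ring
  rw [hval]
  refine mul_le_mul_of_nonneg_left ?_ hw
  rw [le_div_iff₀ (by positivity)]
  rcases le_total 1 m with h | h
  · rw [min_eq_left h]
    linarith
  · rw [min_eq_right h]
    nlinarith

-- The union bound has the form `α (1/M + q β)` and the second-moment bound the form `min 1 (|N| p)`
-- with `p` of order `1/M + q(T)`. The hypotheses on `N` and `T` make these agree, and where the
-- minimum is `1` the trivial bound replaces the union bound.
open Classical in
theorem codeMean_sent_compare {q : A → ℝ} (hq : IsDistribution q) (hM : 0 < M) {i : I}
    (j : Fin M) {x : A} (hx : 0 < q x) {α : I → ℝ} {β : A → ℝ} (hα : ∀ i, 0 < α i)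
    (hβ : ∀ a, 0 < β a) {K : ℝ} (hK1 : 1 ≤ K) (hKα : ∑ i, 1 / α i ≤ K) (hKβ : ∑ a, 1 / β a ≤ K)
    {K' : ℝ} (hK'1 : 1 ≤ K') {N : Finset I} (hi : i ∉ N) {T : Finset A} (hxT : x ∈ T)
    (hN : α i ≤ K' * N.card) (hT : q x * β x ≤ K' * ∑ a ∈ T, q a) :
    codeMean q (fun f C => sent i j x f C *
        if ∃ i' ≠ i, q (C (f i')) * β (C (f i')) * α i' ≤ q x * β x * α i then 1 else 0) ≤
      6 * (K ^ 2 * K' ^ 2) *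
        codeMean q (fun f C => sent i j x f C * if ∃ i' ∈ N, C (f i') ∈ T then 1 else 0) := by
  have hM' : (1 : ℝ) ≤ M := by exact_mod_cast hM
  have hT0 : 0 ≤ ∑ a ∈ T, q a := Finset.sum_nonneg fun a _ => hq.1 a
  have hT1 : ∑ a ∈ T, q a ≤ 1 := by
    rw [← hq.2]
    exact Finset.sum_le_sum_of_subset_of_nonneg (Finset.subset_univ _) fun a _ _ => hq.1 a
  have hlow := le_codeMean_sent_exists hq hM (i := i) j hi hxT
  set p : ℝ := (1 + (M - 1) * ∑ a ∈ T, q a) / M with hp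
  -- Equivalent to `0 ≤ 1 + (M - 2) q(T)`, which for `M = 1` uses `q(T) ≤ 1`.
  have hpM : 1 / (M : ℝ) + ∑ a ∈ T, q a ≤ 2 * p := by
    rw [hp, ← mul_div_assoc, le_div_iff₀ (by linarith), add_mul, one_div,
      inv_mul_cancel₀ (by positivity)]
    nlinarith
  have hw : 0 ≤ q x / M := by positivity
  have hup : codeMean q (fun f C => sent i j x f C *
        if ∃ i' ≠ i, q (C (f i')) * β (C (f i')) * α i' ≤ q x * β x * α i then 1 else 0) ≤
      q x / M * (2 * (K ^ 2 * K' ^ 2) * min 1 (N.card * p)) := by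
    have hD : 1 ≤ 2 * (K ^ 2 * K' ^ 2) := by
      have := one_le_pow₀ hK1 (n := 2)
      have := one_le_pow₀ hK'1 (n := 2)
      nlinarith
    rcases le_total 1 ((N.card : ℝ) * p) with h | h
    · rw [min_eq_left h, mul_one]
      refine le_trans ?_ (le_mul_of_one_le_right hw hD)
      rw [← codeMean_sent hq.2 hM i j x]
      refine codeMean_mono hq.1 fun f C _ => mul_le_of_le_one_right (sent_nonneg i j x f C) ?_
      split_ifs <;> norm_num
    · rw [min_eq_right h]
      refine (codeMean_sent_exists_le hq hM i j hx hα hβ hK1 hKα hKβ).trans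
        (mul_le_mul_of_nonneg_left ?_ hw)
      have h1 : 1 / (M : ℝ) + q x * β x ≤ K' * (2 * p) := by
        have : 1 / (M : ℝ) ≤ K' * (1 / M) := le_mul_of_one_le_left (by positivity) hK'1
        nlinarith
      have h2 : α i * (1 / M + q x * β x) ≤ K' * N.card * (K' * (2 * p)) :=
        mul_le_mul hN h1 (by have := hβ x; positivity) ((hα i).le.trans hN)
      calc K ^ 2 * α i * (1 / M + q x * β x) = K ^ 2 * (α i * (1 / M + q x * β x)) := by ring
        _ ≤ K ^ 2 * (K' * N.card * (K' * (2 * p))) := mul_le_mul_of_nonneg_left h2 (by positivity)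
        _ = _ := by ring
  refine hup.trans ?_
  refine le_trans (le_of_eq ?_) (mul_le_mul_of_nonneg_left hlow (by positivity))
  ring

end RandomCoding

/-! ### Finite-state probabilities -/

section Probabilities

theorem driveState_congr {S Γ : Type*} {n : ℕ} (step : S → Γ → S) (s : S) {a b : Fin n → Γ}
    (t : ℕ) (h : ∀ i : Fin n, (i : ℕ) < t → a i = b i) :
    driveState step s a t = driveState step s b t := by
  induction t with
  | zero => rfl
  | succ t ih =>
    rw [driveState, driveState, ih fun i hi => h i (Nat.lt_succ_of_lt hi)]
    by_cases ht : t < n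
    · rw [dif_pos ht, dif_pos ht, h ⟨t, ht⟩ (Nat.lt_succ_self t)]
    · rw [dif_neg ht, dif_neg ht]

/-- Used to build sequences of positive probability by picking, in each state reached, a letter that
is possible there. -/
theorem exists_feedback_sequence {S Γ : Type*} {n : ℕ} (step : S → Γ → S) (s : S)
    (c : Fin n → S → Γ) : ∃ a : Fin n → Γ, ∀ t : Fin n, a t = c t (driveState step s a t) := by
  let σ : ℕ → S := fun t => Nat.rec s
    (fun t st => if h : t < n then step st (c ⟨t, h⟩ st) else st) t
  refine ⟨fun t => c t (σ t), fun t => ?_⟩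
  have : ∀ t : ℕ, driveState step s (fun t => c t (σ t)) t = σ t := by
    intro t
    induction t with
    | zero => rfl
    | succ t ih => rw [driveState, ih]
  rw [this]

theorem IsDistribution.exists_pos {A : Type*} [Fintype A] {q : A → ℝ} (hq : IsDistribution q) :
    ∃ a, 0 < q a := by
  by_contra! h
  have := Finset.sum_nonpos fun a (_ : a ∈ Finset.univ) => h a
  rw [hq.2] at this
  linarith

theorem IsDistribution.le_one {A : Type*} [Fintype A] {q : A → ℝ} (hq : IsDistribution q)
    (a : A) : q a ≤ 1 := by
  rw [← hq.2]
  exact Finset.single_le_sum (fun a _ => hq.1 a) (Finset.mem_univ a)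

variable {U V S X Y Z : Type*} {n : ℕ}

theorem FiniteStateSource.seqProb_nonneg [Fintype U] [Fintype V] (src : FiniteStateSource U V S)
    (s : S) (u : Fin n → U) (v : Fin n → V) : 0 ≤ src.seqProb s u v :=
  Finset.prod_nonneg fun _ _ => (src.isDistribution _).1 _

theorem FiniteStateChannel.seqProb_nonneg [Fintype Y] (W : FiniteStateChannel X Y Z) (z : Z)
    (x : Fin n → X) (y : Fin n → Y) : 0 ≤ W.seqProb z x y :=
  Finset.prod_nonneg fun _ _ => (W.isDistribution _ _).1 _

theorem FiniteStateSource.exists_seqProb_pos [Fintype U] [Fintype V]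
    (src : FiniteStateSource U V S) (s : S) (n : ℕ) :
    ∃ (u : Fin n → U) (v : Fin n → V), 0 < src.seqProb s u v := by
  choose c hc using fun s => (src.isDistribution s).exists_pos
  obtain ⟨a, ha⟩ := exists_feedback_sequence (n := n)
    (fun s (a : U × V) => src.next s a.1 a.2) s fun _ => c
  refine ⟨fun t => (a t).1, fun t => (a t).2, Finset.prod_pos fun t _ => ?_⟩
  show 0 < src.prob (driveState _ s a t) (a t)
  rw [ha t]
  exact hc _

theorem FiniteStateChannel.exists_seqProb_pos [Fintype Y] (W : FiniteStateChannel X Y Z) (z : Z)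
    (x : Fin n → X) : ∃ y : Fin n → Y, 0 < W.seqProb z x y := by
  choose c hc using fun z x => (W.isDistribution z x).exists_pos
  obtain ⟨a, ha⟩ := exists_feedback_sequence (fun z (a : X × Y) => W.next z a.1 a.2) z
    fun t z => (x t, c z (x t))
  have hx : ∀ t, x t = (a t).1 := fun t => by rw [ha t]
  have hfun : (fun i => (x i, (a i).2)) = a := funext fun i => Prod.ext (hx i) rfl
  refine ⟨fun t => (a t).2, Finset.prod_pos fun t _ => ?_⟩
  simp only [hfun]
  rw [ha t]
  exact hc _ _

theorem FiniteStateSource.exists_pos_le_prob [Fintype U] [Fintype V] [Finite S]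
    (src : FiniteStateSource U V S) (s : S) :
    ∃ δ : ℝ, 0 < δ ∧ δ ≤ 1 ∧ ∀ s a, 0 < src.prob s a → δ ≤ src.prob s a := by
  obtain ⟨a₀, -⟩ := (src.isDistribution s).exists_pos
  have : Nonempty (S × (U × V)) := ⟨(s, a₀)⟩
  obtain ⟨m, hm⟩ := Finite.exists_min fun t : S × (U × V) =>
    if 0 < src.prob t.1 t.2 then src.prob t.1 t.2 else 1
  refine ⟨if 0 < src.prob m.1 m.2 then src.prob m.1 m.2 else 1, ?_, ?_, fun s a h => ?_⟩
  · split_ifs with h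
    · exact h
    · exact one_pos
  · split_ifs
    · exact (src.isDistribution _).le_one _
    · exact le_rfl
  · have := hm (s, a)
    simpa only [h, if_true] using this

/-- Ambiguity, quantitatively: another source vector is almost as likely as the given one. -/
theorem FiniteStateSource.Ambiguous.exists_le [Fintype U] [Fintype V] [Finite S]
    {src : FiniteStateSource U V S} {s : S} (h : src.Ambiguous s) :
    ∃ κ : ℝ, 0 < κ ∧ κ ≤ 1 ∧ ∀ᶠ n : ℕ in atTop, ∀ (u : Fin n → U) (v : Fin n → V),
      0 < src.seqProb s u v → ∃ u' ≠ u, κ * src.seqProb s u v ≤ src.seqProb s u' v := by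
  obtain ⟨L, hL⟩ := h
  obtain ⟨δ, hδ0, hδ1, hδ⟩ := src.exists_pos_le_prob s
  refine ⟨δ ^ L, pow_pos hδ0 L, pow_le_one₀ hδ0.le hδ1, ?_⟩
  filter_upwards [eventually_ge_atTop L] with n hn u v huv
  obtain ⟨u', hne, hpre, hpos⟩ := hL n hn u v huv
  refine ⟨u', hne, ?_⟩
  have hcard : (Finset.univ.filter fun t : Fin n => ¬ (t : ℕ) + L < n).card ≤ L := by
    refine (Finset.card_le_card_of_injOn (t := Finset.range L) (fun t : Fin n => n - 1 - (t : ℕ))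
      ?_ ?_).trans (Finset.card_range L).le
    · intro t ht
      have h1 := (Finset.mem_filter.1 (Finset.mem_coe.1 ht)).2
      have h2 := t.2
      refine Finset.mem_coe.2 (Finset.mem_range.2 ?_)
      show n - 1 - (t : ℕ) < L
      omega
    · intro t _ t' _ htt
      have h1 := t.2
      have h2 := t'.2
      have h3 : n - 1 - (t : ℕ) = n - 1 - (t' : ℕ) := htt
      exact Fin.ext (by omega)
  -- Before the last `L` positions states and letters agree, so the factors are equal. In the last
  -- `L` the factors of `u'` are nonzero, hence at least `δ`, and those of `u` are at most `1`.
  have hprod : δ ^ L ≤ ∏ t : Fin n, if (t : ℕ) + L < n then 1 else δ := by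
    rw [Finset.prod_ite, Finset.prod_const_one, one_mul, Finset.prod_const]
    exact pow_le_pow_of_le_one hδ0.le hδ1 hcard
  refine (mul_le_mul_of_nonneg_right hprod huv.le).trans ?_
  unfold FiniteStateSource.seqProb
  rw [← Finset.prod_mul_distrib]
  refine Finset.prod_le_prod (fun t _ => ?_) fun t _ => ?_
  · refine mul_nonneg ?_ ((src.isDistribution _).1 _)
    split_ifs
    · exact zero_le_one
    · exact hδ0.le
  · split_ifs with ht
    · rw [one_mul, hpre t ht]
      refine le_of_eq (congrArg (fun st => src.prob st (u t, v t)) ?_)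
      refine driveState_congr _ _ _ fun i hi => ?_
      rw [hpre i (by omega)]
    · refine (mul_le_of_le_one_right hδ0.le ((src.isDistribution _).le_one _)).trans (hδ _ _ ?_)
      refine lt_of_le_of_ne ((src.isDistribution _).1 _) fun h0 => hpos.ne' ?_
      exact Finset.prod_eq_zero (Finset.mem_univ t) h0.symm

theorem FiniteStateSource.seqProb_of_mem_pathClass [Fintype U] [Fintype V]
    (src : FiniteStateSource U V S) (s : S) {u u' : Fin n → U} {v : Fin n → V}
    (h : u' ∈ pathClass (fun s (a : U × V) => src.next s a.1 a.2) s u v) :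
    src.seqProb s u' v = src.seqProb s u v := by
  obtain ⟨π, hπ⟩ := mem_pathClass.1 h
  unfold FiniteStateSource.seqProb
  conv_rhs => rw [← Equiv.prod_comp π]
  exact Finset.prod_congr rfl fun t _ =>
    congrArg (fun e : S × U × V => src.prob e.1 e.2) (congrFun hπ t)

theorem FiniteStateChannel.seqProb_of_mem_pathClass [Fintype X] [Fintype Y]
    (W : FiniteStateChannel X Y Z) (z : Z) {x x' : Fin n → X} {y : Fin n → Y}
    (h : x' ∈ pathClass (fun z (a : X × Y) => W.next z a.1 a.2) z x y) :
    W.seqProb z x' y = W.seqProb z x y := by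
  obtain ⟨π, hπ⟩ := mem_pathClass.1 h
  unfold FiniteStateChannel.seqProb
  conv_rhs => rw [← Equiv.prod_comp π]
  exact Finset.prod_congr rfl fun t _ =>
    congrArg (fun e : Z × X × Y => W.prob e.1 e.2.1 e.2.2) (congrFun hπ t)

theorem Exchangeable.eq_of_mem_pathClass [Fintype X] {q : (Fin n → X) → ℝ} (hq : Exchangeable q)
    (step : Z → X × Y → Z) (z : Z) {x x' : Fin n → X} {y : Fin n → Y}
    (h : x' ∈ pathClass step z x y) : q x' = q x := by
  obtain ⟨π, hπ⟩ := mem_pathClass.1 h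
  exact hq x x' ⟨π, funext fun t => congrArg (fun e : Z × X × Y => e.2.1) (congrFun hπ t)⟩

theorem InputDrivenComponent.seq_eq_proj [Fintype Y] {T : Type*} {W : FiniteStateChannel X Y Z}
    (c : InputDrivenComponent W T) (z : Z) (x : Fin n → X) (y : Fin n → Y) (t : Fin n) :
    c.seq z x t =
      c.proj (driveState (fun z (a : X × Y) => W.next z a.1 a.2) z (fun i => (x i, y i)) t) := by
  have : ∀ t : ℕ, driveState c.next (c.proj z) x t =
      c.proj (driveState (fun z (a : X × Y) => W.next z a.1 a.2) z (fun i => (x i, y i)) t) := by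
    intro t
    induction t with
    | zero => rfl
    | succ t ih =>
      rw [driveState, driveState, ih]
      split_ifs
      · rw [c.compat]
      · rfl
  exact this t

/-- A rearrangement of (state, input, output) triples projects to a rearrangement of `(x, σ)`. -/
theorem InputDrivenComponent.Invariant.eq_of_mem_pathClass [Fintype X] [Fintype Y] {T : Type*}
    {W : FiniteStateChannel X Y Z} {c : InputDrivenComponent W T} {z : Z} {q : (Fin n → X) → ℝ}
    (hq : c.Invariant z q) {x x' : Fin n → X} {y : Fin n → Y}
    (h : x' ∈ pathClass (fun z (a : X × Y) => W.next z a.1 a.2) z x y) : q x' = q x := by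
  obtain ⟨π, hπ⟩ := mem_pathClass.1 h
  refine hq x x' ⟨π, funext fun t => ?_⟩
  rw [c.seq_eq_proj z x' y, Function.comp_apply, c.seq_eq_proj z x y]
  exact congrArg (fun e : Z × X × Y => (e.2.1, c.proj e.1)) (congrFun hπ t)

end Probabilities

/-! ### Comparison of the decoders -/

section Decoding

/-- Up to the factor `-1/n`, the metric is the logarithm of this product, so maximizing one
minimizes the other. -/
theorem lz_metric_le {U V X Y : Type*} [DecidableEq U] [DecidableEq V] [DecidableEq X]
    [DecidableEq Y] {n : ℕ} {q : (Fin n → X) → ℝ} (hn : 0 < n)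
    {u u' : Fin n → U} {v : Fin n → V}
    {x x' : Fin n → X} {y : Fin n → Y} (hx : 0 < q x) (hx' : 0 < q x')
    (h : infoLZ q x y - condLZ u v ≤ infoLZ q x' y - condLZ u' v) :
    q x' * lzWeight x' y * lzWeight u' v ≤ q x * lzWeight x y * lzWeight u v := by
  have hn' : (0 : ℝ) < n := by exact_mod_cast hn
  have key : ∀ (u : Fin n → U) (x : Fin n → X), 0 < q x → infoLZ q x y - condLZ u v =
      -(Real.logb 2 (q x * lzWeight x y * lzWeight u v) / n) := by
    intro u x hx
    have h1 : ((lzWeight x y : ℕ) : ℝ) ≠ 0 := Nat.cast_ne_zero.2 (lzWeight_pos x y).ne'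
    have h2 : ((lzWeight u v : ℕ) : ℝ) ≠ 0 := Nat.cast_ne_zero.2 (lzWeight_pos u v).ne'
    rw [infoLZ, condLZ_eq, condLZ_eq, Real.logb_mul (mul_ne_zero hx.ne' h1) h2,
      Real.logb_mul hx.ne' h1]
    ring
  rw [key u x hx, key u' x' hx', neg_le_neg_iff, div_le_div_iff_of_pos_right hn'] at h
  have hp : ∀ (u : Fin n → U) (x : Fin n → X), 0 < q x → 0 < q x * lzWeight x y * lzWeight u v :=
    fun u x hx => mul_pos (mul_pos hx (Nat.cast_pos.2 (lzWeight_pos x y)))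
      (Nat.cast_pos.2 (lzWeight_pos u v))
  exact (Real.logb_le_logb one_lt_two (hp u' x' hx') (hp u x hx)).1 h

variable {U V S X Y Z : Type*} [Fintype U] [Fintype V] [Fintype X] [Fintype Y]
  [DecidableEq U] {n M : ℕ}

theorem numBins_pos (R : ℝ) (n : ℕ) : 0 < numBins R n :=
  Nat.ceil_pos.2 (Real.rpow_pos_of_pos two_pos _)

theorem errorProb_eq (src : FiniteStateSource U V S) (s : S) (W : FiniteStateChannel X Y Z)
    (z : Z) (q : (Fin n → X) → ℝ) (d : Decoder U V X Y n M) :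
    errorProb src s W z q d = codeMean q (fun f C => ∑ v : Fin n → V, ∑ y : Fin n → Y,
      ∑ u : Fin n → U, src.seqProb s u v * W.seqProb z (C (f u)) y *
        if d f C v y ≠ u then 1 else 0) := by
  unfold errorProb codeMean
  refine Finset.sum_congr rfl fun f _ => Finset.sum_congr rfl fun C _ => ?_
  rw [Finset.sum_comm]
  simp_rw [Finset.mul_sum]
  refine Finset.sum_congr rfl fun v _ => ?_
  rw [Finset.sum_comm]
  exact Finset.sum_congr rfl fun y _ => Finset.sum_congr rfl fun u _ => by ring

/-- For each `(f, C, v, y)` the error mass is the total mass minus that of the decoded vector, which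
MAP makes largest. -/
theorem errorProb_le_of_isMAPDecoder {src : FiniteStateSource U V S} {s : S}
    {W : FiniteStateChannel X Y Z} {z : Z} {q : (Fin n → X) → ℝ} (hq : IsDistribution q)
    {d : Decoder U V X Y n M} (hd : IsMAPDecoder src s W z d) (d' : Decoder U V X Y n M) :
    errorProb src s W z q d ≤ errorProb src s W z q d' := by
  rw [errorProb_eq, errorProb_eq]
  refine codeMean_mono hq.1 fun f C _ => Finset.sum_le_sum fun v _ =>
    Finset.sum_le_sum fun y _ => ?_
  have key : ∀ d : Decoder U V X Y n M,
      ∑ u : Fin n → U, src.seqProb s u v * W.seqProb z (C (f u)) y *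
        (if d f C v y ≠ u then 1 else 0) =
      ∑ u : Fin n → U, src.seqProb s u v * W.seqProb z (C (f u)) y -
        src.seqProb s (d f C v y) v * W.seqProb z (C (f (d f C v y))) y := by
    intro d
    rw [eq_sub_iff_add_eq, ← Finset.add_sum_erase _ _ (Finset.mem_univ (d f C v y)),
      ← Finset.add_sum_erase (a := d f C v y) _
        (fun u => src.seqProb s u v * W.seqProb z (C (f u)) y) (Finset.mem_univ _)]
    rw [if_neg (by simp), mul_zero, zero_add, add_comm]
    congr 1
    refine Finset.sum_congr rfl fun u hu => ?_
    rw [if_pos (Finset.ne_of_mem_erase hu).symm, mul_one]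
  rw [key, key]
  linarith [hd f C v y (d' f C v y)]

open Classical in
/-- Every decision rule errs, up to a constant factor, at least as often as the true vector has
a competitor of comparable weight. -/
theorem sum_competitor_le {I : Type*} [Fintype I] [DecidableEq I] {w : I → ℝ} (hw : ∀ i, 0 ≤ w i) {κ : ℝ}
    (hκ : 0 < κ) (d : I) :
    ∑ i, w i * (if ∃ i' ≠ i, κ * w i ≤ w i' then 1 else 0) ≤
      (1 + 1 / κ) * ∑ i, w i * if d ≠ i then 1 else 0 := by
  have h1 : ∑ i, w i * (if d ≠ i then 1 else 0) = ∑ i ∈ Finset.univ.erase d, w i := by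
    rw [← Finset.add_sum_erase _ _ (Finset.mem_univ d), if_neg (by simp), mul_zero, zero_add]
    refine Finset.sum_congr rfl fun i hi => ?_
    rw [if_pos (Finset.ne_of_mem_erase hi).symm, mul_one]
  rw [h1, add_mul, one_mul, ← Finset.add_sum_erase _ _ (Finset.mem_univ d), add_comm]
  -- Every index other than `d` is an error already. If `d` has a competitor `i'`, then `w d ≤ w i'
  -- / κ`, and `i'` is an error.
  refine add_le_add (Finset.sum_le_sum fun i _ => mul_le_of_le_one_right (hw i) ?_) ?_
  · split_ifs <;> norm_num
  · split_ifs with h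
    · obtain ⟨i', hi', hle⟩ := h
      rw [mul_one, one_div, ← div_eq_inv_mul, le_div_iff₀ hκ, mul_comm]
      exact hle.trans (Finset.single_le_sum (fun i _ => hw i)
        (Finset.mem_erase.2 ⟨hi', Finset.mem_univ i'⟩))
    · rw [mul_zero]
      exact mul_nonneg (by positivity) (Finset.sum_nonneg fun i _ => hw i)

/-- When all vectors fall in one bin, `u` and `u'` give the same channel input, so for the same `v`
and `y` the decoder misses one of them. -/
theorem errorProb_pos {src : FiniteStateSource U V S} {s : S} {W : FiniteStateChannel X Y Z}
    {z : Z} {q : (Fin n → X) → ℝ} (hq : IsDistribution q) (hM : 0 < M) {u u' : Fin n → U}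
    {v : Fin n → V} (hne : u' ≠ u) (hu : 0 < src.seqProb s u v) (hu' : 0 < src.seqProb s u' v)
    (d : Decoder U V X Y n M) : 0 < errorProb src s W z q d := by
  obtain ⟨x, hx⟩ := hq.exists_pos
  obtain ⟨y, hy⟩ := W.exists_seqProb_pos z x
  let f : (Fin n → U) → Fin M := fun _ => ⟨0, hM⟩
  let C : Fin M → Fin n → X := fun _ => x
  obtain ⟨u₀, hu₀, hd⟩ : ∃ u₀, 0 < src.seqProb s u₀ v ∧ d f C v y ≠ u₀ := by
    by_cases h : d f C v y = u
    · exact ⟨u', hu', fun h' => hne (h'.symm.trans h)⟩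
    · exact ⟨u, hu, h⟩
  have hnn : ∀ (f : (Fin n → U) → Fin M) (C : Fin M → Fin n → X) (u : Fin n → U) (v : Fin n → V)
      (y : Fin n → Y), 0 ≤ (∏ _u : Fin n → U, (1 / (M : ℝ))) * (∏ j, q (C j)) *
        (src.seqProb s u v * W.seqProb z (C (f u)) y) * (if d f C v y ≠ u then 1 else 0) := by
    intro f C u v y
    refine mul_nonneg (mul_nonneg (mul_nonneg (Finset.prod_nonneg fun _ _ => by positivity)
      (Finset.prod_nonneg fun _ _ => hq.1 _))
      (mul_nonneg (src.seqProb_nonneg _ _ _) (W.seqProb_nonneg _ _ _))) ?_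
    split_ifs <;> norm_num
  unfold errorProb
  refine Finset.sum_pos' (fun f _ => Finset.sum_nonneg fun C _ => Finset.sum_nonneg fun u _ =>
    Finset.sum_nonneg fun v _ => Finset.sum_nonneg fun y _ => hnn f C u v y)
    ⟨f, Finset.mem_univ _, ?_⟩
  refine Finset.sum_pos' (fun C _ => Finset.sum_nonneg fun u _ =>
    Finset.sum_nonneg fun v _ => Finset.sum_nonneg fun y _ => hnn f C u v y)
    ⟨C, Finset.mem_univ _, ?_⟩
  refine Finset.sum_pos' (fun u _ => Finset.sum_nonneg fun v _ => Finset.sum_nonneg fun y _ =>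
    hnn f C u v y) ⟨u₀, Finset.mem_univ _, ?_⟩
  refine Finset.sum_pos' (fun v _ => Finset.sum_nonneg fun y _ => hnn f C u₀ v y)
    ⟨v, Finset.mem_univ _, ?_⟩
  refine Finset.sum_pos' (fun y _ => hnn f C u₀ v y) ⟨y, Finset.mem_univ _, ?_⟩
  rw [if_pos hd, mul_one]
  refine mul_pos (mul_pos (Finset.prod_pos fun _ _ => ?_) (Finset.prod_pos fun _ _ => hx))
    (mul_pos hu₀ hy)
  positivity

theorem codeMean_comm_sum (q : (Fin n → X) → ℝ)
    (F : (Fin n → U) → (Fin n → V) → (Fin n → Y) →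
      ((Fin n → U) → Fin M) → (Fin M → Fin n → X) → ℝ) :
    codeMean q (fun f C => ∑ v, ∑ y, ∑ u, F u v y f C) =
      ∑ v, ∑ y, ∑ u, codeMean q (F u v y) := by
  rw [codeMean_sum]
  refine Finset.sum_congr rfl fun v _ => ?_
  rw [codeMean_sum]
  exact Finset.sum_congr rfl fun y _ => codeMean_sum _ _ _

variable [DecidableEq V] [DecidableEq X] [DecidableEq Y]

/-- Splitting a mean according to the bin of the source vector and the transmitted codeword. -/
theorem codeMean_eq_sum_sent (q : (Fin n → X) → ℝ) (u : Fin n → U) (w : (Fin n → X) → ℝ)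
    (g : ((Fin n → U) → Fin M) → (Fin M → Fin n → X) → ℝ) :
    codeMean q (fun f C => w (C (f u)) * g f C) =
      ∑ j, ∑ x, w x * codeMean q (fun f C => sent u j x f C * g f C) := by
  simp_rw [← codeMean_mul, ← codeMean_sum]
  congr 1
  ext f C
  simp [sent]

open Classical in
/-- The universal decoder against an arbitrary decoder, for a fixed block length. -/
theorem errorProb_lz_le {src : FiniteStateSource U V S} {s : S} {W : FiniteStateChannel X Y Z}
    {z : Z} {q : (Fin n → X) → ℝ} (hq : IsDistribution q) (hn : 0 < n) (hM : 0 < M)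
    (hinv : ∀ (y : Fin n → Y) (x : Fin n → X),
      ∀ x' ∈ pathClass (fun z (a : X × Y) => W.next z a.1 a.2) z x y, q x' = q x)
    {κ : ℝ} (hκ0 : 0 < κ) (hκ1 : κ ≤ 1)
    (hκ : ∀ (u : Fin n → U) (v : Fin n → V), 0 < src.seqProb s u v →
      ∃ u' ≠ u, κ * src.seqProb s u v ≤ src.seqProb s u' v)
    {K : ℝ} (hK : 1 ≤ K)
    (hKU : ∀ v : Fin n → V, ∑ u : Fin n → U, (1 / (lzWeight u v : ℝ)) ≤ K)
    (hKX : ∀ y : Fin n → Y, ∑ x : Fin n → X, (1 / (lzWeight x y : ℝ)) ≤ K)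
    (hcU : ∀ (u : Fin n → U) (v : Fin n → V), (lzWeight u v : ℝ) ≤
      K * (pathClass (fun s (a : U × V) => src.next s a.1 a.2) s u v).card)
    (hcX : ∀ (x : Fin n → X) (y : Fin n → Y), (lzWeight x y : ℝ) ≤
      K * (pathClass (fun z (a : X × Y) => W.next z a.1 a.2) z x y).card)
    {d : Decoder U V X Y n M} (hd : IsLZDecoder q d) (d' : Decoder U V X Y n M) :
    errorProb src s W z q d ≤ 24 * K ^ 4 * (1 + 1 / κ) * errorProb src s W z q d' := by
  have hpt : ∀ (u : Fin n → U) (v : Fin n → V) (y : Fin n → Y),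
      codeMean q (fun f C => src.seqProb s u v * W.seqProb z (C (f u)) y *
        if d f C v y ≠ u then 1 else 0) ≤
      24 * K ^ 4 * codeMean (M := M) q (fun f C => src.seqProb s u v * W.seqProb z (C (f u)) y *
        if ∃ u' ≠ u, κ * (src.seqProb s u v * W.seqProb z (C (f u)) y) ≤
          src.seqProb s u' v * W.seqProb z (C (f u')) y then 1 else 0) := by
    intro u v y
    rcases (src.seqProb_nonneg s u v).eq_or_lt with h0 | huv
    · simp [← h0, codeMean]
    rw [codeMean_eq_sum_sent q u fun x => src.seqProb s u v * W.seqProb z x y,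
      codeMean_eq_sum_sent q u fun x => src.seqProb s u v * W.seqProb z x y, Finset.mul_sum]
    refine Finset.sum_le_sum fun j _ => ?_
    rw [Finset.mul_sum]
    refine Finset.sum_le_sum fun x _ => ?_
    rw [mul_left_comm]
    have hW := W.seqProb_nonneg z x y
    refine mul_le_mul_of_nonneg_left ?_ (mul_nonneg huv.le hW)
    rcases (hq.1 x).eq_or_lt with hx0 | hx
    · rw [← codeMean_mul]
      refine codeMean_mono hq.1 fun f C hC => ?_
      have : C j ≠ x := fun h => by
        have := hC j
        rw [h, ← hx0] at this
        exact lt_irrefl _ this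
      simp [sent, this]
    set N : Finset (Fin n → U) := Finset.univ.filter fun u' =>
      u' ≠ u ∧ κ * src.seqProb s u v ≤ src.seqProb s u' v with hN
    set T := pathClass (fun z (a : X × Y) => W.next z a.1 a.2) z x y with hT
    -- The class without `u` lies in `N`, and ambiguity makes `N` nonempty even if the class is
    -- `{u}`. Hence the factor `2`, so that `K' = 2 K` and `6 K² (2 K)² = 24 K⁴` below.
    have hNcard : (pathClass (fun s (a : U × V) => src.next s a.1 a.2) s u v).card ≤
        2 * N.card := by
      have h1 : (pathClass (fun s (a : U × V) => src.next s a.1 a.2) s u v).erase u ⊆ N := by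
        intro u' hu'
        obtain ⟨h2, h3⟩ := Finset.mem_erase.1 hu'
        refine Finset.mem_filter.2 ⟨Finset.mem_univ _, h2, ?_⟩
        rw [src.seqProb_of_mem_pathClass s h3]
        exact mul_le_of_le_one_left huv.le hκ1
      have h2 := Finset.card_le_card h1
      rw [Finset.card_erase_of_mem (self_mem_pathClass _ _ _ _)] at h2
      obtain ⟨u', hu', hle⟩ := hκ u v huv
      have h3 : 0 < N.card := Finset.card_pos.2 ⟨u', Finset.mem_filter.2
        ⟨Finset.mem_univ _, hu', hle⟩⟩
      omega
    have hTsum : ∑ x' ∈ T, q x' = T.card * q x := by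
      rw [Finset.sum_congr rfl (hinv y x), Finset.sum_const, nsmul_eq_mul]
    have hcmp := codeMean_sent_compare hq hM (i := u) j hx
      (α := fun u => (lzWeight u v : ℝ)) (β := fun x => (lzWeight x y : ℝ))
      (fun u => Nat.cast_pos.2 (lzWeight_pos u v)) (fun x => Nat.cast_pos.2 (lzWeight_pos x y))
      hK (hKU v) (hKX y) (K' := 2 * K) (by linarith) (N := N) (by simp [hN]) (T := T)
      (self_mem_pathClass _ _ _ _)
      (by
        have h1 : ((pathClass (fun s (a : U × V) => src.next s a.1 a.2) s u v).card : ℝ) ≤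
            2 * N.card := by exact_mod_cast hNcard
        have := mul_le_mul_of_nonneg_left h1 (by linarith : 0 ≤ K)
        linarith [hcU u v])
      (by
        rw [hTsum]
        have h1 := mul_le_mul_of_nonneg_left (hcX x y) hx.le
        have h2 : 0 ≤ K * T.card * q x := by positivity
        linarith)
    calc codeMean q (fun f C => sent u j x f C * if d f C v y ≠ u then 1 else 0)
        ≤ codeMean q (fun f C => sent u j x f C *
          if ∃ u' ≠ u, q (C (f u')) * lzWeight (C (f u')) y * lzWeight u' v ≤
            q x * lzWeight x y * lzWeight u v then 1 else 0) := by
          refine codeMean_mono hq.1 fun f C hC => ?_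
          by_cases hs : f u = j ∧ C j = x
          · obtain ⟨rfl, rfl⟩ := hs
            refine mul_le_mul_of_nonneg_left ?_ (sent_nonneg _ _ _ _ _)
            by_cases hdu : d f C v y = u
            · rw [if_neg (not_not.2 hdu)]
              positivity
            · rw [if_pos hdu, if_pos]
              -- The wrongly decoded vector is itself the competitor.
              exact ⟨d f C v y, hdu, lz_metric_le hn (hC _) (hC _) (hd f C v y u)⟩
          · have : sent u j x f C = 0 := by
              unfold sent
              by_cases h1 : f u = j
              · simp [show C j ≠ x from fun h2 => hs ⟨h1, h2⟩]
              · simp [h1]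
            simp [this]
      _ ≤ _ := hcmp
      _ = 24 * K ^ 4 * codeMean q (fun f C => sent u j x f C *
            if ∃ u' ∈ N, C (f u') ∈ T then 1 else 0) := by ring
      _ ≤ _ := by
          refine mul_le_mul_of_nonneg_left (codeMean_mono hq.1 fun f C _ => ?_) (by positivity)
          by_cases hs : f u = j ∧ C j = x
          · obtain ⟨rfl, rfl⟩ := hs
            refine mul_le_mul_of_nonneg_left ?_ (sent_nonneg _ _ _ _ _)
            by_cases hex : ∃ u' ∈ N, C (f u') ∈ T
            · rw [if_pos hex, if_pos]
              obtain ⟨u', hu', hT'⟩ := hex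
              obtain ⟨-, h1, h2⟩ := Finset.mem_filter.1 hu'
              refine ⟨u', h1, ?_⟩
              rw [W.seqProb_of_mem_pathClass z hT', ← mul_assoc]
              exact mul_le_mul_of_nonneg_right h2 hW
            · rw [if_neg hex]
              positivity
          · have : sent u j x f C = 0 := by
              unfold sent
              by_cases h1 : f u = j
              · simp [show C j ≠ x from fun h2 => hs ⟨h1, h2⟩]
              · simp [h1]
            simp [this]
  have hcompet : codeMean (M := M) q (fun f C => ∑ v : Fin n → V, ∑ y : Fin n → Y, ∑ u : Fin n → U,
      src.seqProb s u v * W.seqProb z (C (f u)) y *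
        if ∃ u' ≠ u, κ * (src.seqProb s u v * W.seqProb z (C (f u)) y) ≤
          src.seqProb s u' v * W.seqProb z (C (f u')) y then 1 else 0) ≤
      (1 + 1 / κ) * errorProb src s W z q d' := by
    rw [errorProb_eq, ← codeMean_mul]
    refine codeMean_mono hq.1 fun f C _ => ?_
    rw [Finset.mul_sum]
    refine Finset.sum_le_sum fun v _ => ?_
    rw [Finset.mul_sum]
    refine Finset.sum_le_sum fun y _ => ?_
    exact sum_competitor_le (w := fun u => src.seqProb s u v * W.seqProb z (C (f u)) y)
      (fun u => mul_nonneg (src.seqProb_nonneg _ _ _) (W.seqProb_nonneg _ _ _)) hκ0 (d' f C v y)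
  rw [mul_assoc]
  refine le_trans ?_ (mul_le_mul_of_nonneg_left hcompet (by positivity))
  rw [errorProb_eq, codeMean_comm_sum, codeMean_comm_sum, Finset.mul_sum]
  refine Finset.sum_le_sum fun v _ => ?_
  rw [Finset.mul_sum]
  refine Finset.sum_le_sum fun y _ => ?_
  rw [Finset.mul_sum]
  exact Finset.sum_le_sum fun u _ => hpt u v y

end Decoding

/-! ### The limit -/

theorem theorem2 {U V S X Y Z : Type*}
    [Fintype U] [Fintype V] [Fintype X] [Fintype Y] [Finite S] [Finite Z]
    [DecidableEq U] [DecidableEq V] [DecidableEq X] [DecidableEq Y]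
    (src : FiniteStateSource U V S) (s₁ : S) (hsrc : src.Ambiguous s₁)
    (W : FiniteStateChannel X Y Z) (z₁ : Z)
    (R : ℝ) (hR : 0 < R)
    (Q : ∀ n : ℕ, (Fin n → X) → ℝ) (hQ : ∀ n, IsDistribution (Q n))
    (hinv : (∀ n, Exchangeable (Q n)) ∨
      ∃ (k : ℕ) (c : InputDrivenComponent W (Fin k)), ∀ n, c.Invariant z₁ (Q n))
    (dMAP dLZ : ∀ n : ℕ, Decoder U V X Y n (numBins R n))
    (hMAP : ∀ n, IsMAPDecoder src s₁ W z₁ (dMAP n))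
    (hLZ : ∀ n, IsLZDecoder (Q n) (dLZ n)) :
    (∀ᶠ n in atTop, 0 < errorProb src s₁ W z₁ (Q n) (dMAP n) ∧
      0 < errorProb src s₁ W z₁ (Q n) (dLZ n)) ∧
    Tendsto (fun n : ℕ => (1 / (n : ℝ)) *
      Real.logb 2 (errorProb src s₁ W z₁ (Q n) (dLZ n) /
        errorProb src s₁ W z₁ (Q n) (dMAP n))) atTop (𝓝 0) := by
  have hinv' : ∀ n (y : Fin n → Y) (x : Fin n → X),
      ∀ x' ∈ pathClass (fun z (a : X × Y) => W.next z a.1 a.2) z₁ x y, Q n x' = Q n x := by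
    intro n y x x' hx'
    rcases hinv with h | ⟨k, c, h⟩
    · exact (h n).eq_of_mem_pathClass _ _ hx'
    · exact (h n).eq_of_mem_pathClass hx'
  obtain ⟨κ, hκ0, hκ1, hκ⟩ := hsrc.exists_le
  have hpos : ∀ᶠ n in atTop, 0 < errorProb src s₁ W z₁ (Q n) (dMAP n) ∧
      0 < errorProb src s₁ W z₁ (Q n) (dLZ n) := by
    filter_upwards [hκ] with n hn
    obtain ⟨u, v, huv⟩ := src.exists_seqProb_pos s₁ n
    obtain ⟨u', hne, hle⟩ := hn u v huv
    have hu' := (mul_pos hκ0 huv).trans_le hle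
    exact ⟨errorProb_pos (hQ n) (numBins_pos R n) hne huv hu' _,
      errorProb_pos (hQ n) (numBins_pos R n) hne huv hu' _⟩
  refine ⟨hpos, ?_⟩
  have hlog2 : 0 < Real.log 2 := Real.log_pos one_lt_two
  set B : ℝ := 24 * (1 + 1 / κ) with hB
  have hB0 : 0 < B := by positivity
  rw [Metric.tendsto_atTop']
  intro ε hε
  -- With `K = exp (η n)`, the factor `K⁴` contributes `4 η n` to `log r` and the constant `B` less
  -- than `η n`. The total stays below `8 η n = ε n log 2`.
  set η : ℝ := ε * Real.log 2 / 8 with hη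
  have hη0 : 0 < η := by positivity
  obtain ⟨N₁, hN₁⟩ := exists_nat_gt (B / η)
  have hev : ∀ᶠ n : ℕ in atTop, dist ((1 / (n : ℝ)) *
      Real.logb 2 (errorProb src s₁ W z₁ (Q n) (dLZ n) /
        errorProb src s₁ W z₁ (Q n) (dMAP n))) 0 < ε := by
    filter_upwards [hpos, hκ, eventually_gt_atTop 0, eventually_ge_atTop N₁,
      eventually_sum_inv_lzWeight_le U V hη0, eventually_sum_inv_lzWeight_le X Y hη0,
      eventually_lzWeight_le_card_pathClass (S := S) U V hη0,
      eventually_lzWeight_le_card_pathClass (S := Z) X Y hη0]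
      with n hp hn hn0 hnN hKU hKX hcU hcX
    obtain ⟨hp1, hp2⟩ := hp
    have hn0' : (0 : ℝ) < n := by exact_mod_cast hn0
    have hup := errorProb_lz_le (hQ n) hn0 (numBins_pos R n) (hinv' n) hκ0 hκ1 hn
      (K := Real.exp (η * n)) (Real.one_le_exp (by positivity)) hKU hKX
      (fun u v => hcU _ s₁ u v) (fun x y => hcX _ z₁ x y) (hLZ n) (dMAP n)
    have hlow := errorProb_le_of_isMAPDecoder (hQ n) (hMAP n) (dLZ n)
    set r := errorProb src s₁ W z₁ (Q n) (dLZ n) / errorProb src s₁ W z₁ (Q n) (dMAP n) with hr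
    have hr1 : 1 ≤ r := (one_le_div hp1).2 hlow
    have hr2 : r ≤ Real.exp (B + 4 * (η * n)) := by
      rw [hr, div_le_iff₀ hp1]
      refine hup.trans (mul_le_mul_of_nonneg_right ?_ hp1.le)
      rw [← Real.exp_nat_mul, Real.exp_add]
      have : B ≤ Real.exp B := by linarith [Real.add_one_le_exp B]
      have h4 := mul_le_mul_of_nonneg_right this (Real.exp_pos (4 * (η * n))).le
      refine le_trans (le_of_eq ?_) h4
      rw [hB]
      push_cast
      ring
    have hlogr : Real.log r ≤ B + 4 * (η * n) :=
      (Real.log_le_iff_le_exp (by linarith)).2 hr2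
    have h0 : 0 ≤ 1 / (n : ℝ) * Real.logb 2 r :=
      mul_nonneg (by positivity) (Real.logb_nonneg one_lt_two hr1)
    have hBn : B < η * n := by
      rw [div_lt_iff₀ hη0] at hN₁
      have : (N₁ : ℝ) ≤ n := by exact_mod_cast hnN
      nlinarith
    rw [Real.dist_eq, sub_zero, abs_of_nonneg h0, Real.logb, one_div, ← div_eq_inv_mul,
      div_lt_iff₀ hn0', div_lt_iff₀ hlog2]
    have : ε * n * Real.log 2 = 8 * (η * n) := by rw [hη]; ring
    rw [this]
    have : 0 < η * n := by positivity
    linarith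
  obtain ⟨N, hN⟩ := eventually_atTop.1 hev
  exact ⟨N, fun n hn => hN n hn.le⟩
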